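/- \textbf{Setting.} Let $m\ge 1$ be the number of items and $[m]=\{1,\dots,m\}$. A function $v:2^{[m]}\to\mathbb R$ is \emph{Binary-XOS} if there is a non-empty collection $\mathcal C\subseteq 2^{[m]}$ with $v(S)=\max_{C\in\mathcal C}|S\cap C|$ for all $S\subseteq[m]$; let $\mathtt{BXOS}_m$ be the class of these functions. For $v^A,v^B\in\mathtt{BXOS}_m$ let $\mathsf{opt}(v^A,v^B)=\max\{v^A(S^A)+v^B(S^B): S^A,S^B\subseteq[m],\ S^A\cap S^B=\emptyset\}$. A deterministic protocol for two bidders (Alice and Bob) and a seller proceeds in rounds. In each round Alice sends the seller a finite bit string depending on $v^A$ and on the messages she has received so far, and Bob likewise with $v^B$. The seller then, depending on all messages received so far, either sends one finite bit string to each bidder or ends the communication. At the end the seller outputs disjoint sets $(O^A,O^B)$ of items for Alice and Bob, and prices, as functions of all messages received. The communication complexity of a deterministic protocol is the maximum over inputs $v^A,v^B\in\mathtt{BXOS}_m$ of the total number of bits exchanged ($\infty$ if the execution does not end). The protocol is \emph{simultaneous} if it ends after exactly one round on all inputs. A randomized protocol $\Pi$ is a probability distribution over deterministic protocols. It is simultaneous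 if (almost) all deterministic protocols in its support are, and $\mathsf{CC}(\Pi)$ is the (essential) supremum of the communication complexities of the deterministic protocols in its support. It is \emph{$\alpha$-approximate with probability $p$} if for all $v^A,v^B\in\mathtt{BXOS}_m$, with probability at least $p$ over the choice of the deterministic protocol, the resulting allocation satisfies $v^A(O^A)+v^B(O^B)\ \ge\ \alpha\cdot\mathsf{opt}(v^A,v^B)$. \textbf{Theorem.} For all $\varepsilon>0$ and all integers $m>\frac{10^{10}}{\varepsilon^2}$, any randomized simultaneous two-bidder protocol $\Pi$ for $\mathtt{BXOS}_m$ that is $\left(\frac34-\frac1{240}+\varepsilon\right)$-approximate with probability $\frac12+\exp\left(-\frac{\varepsilon^2 m}{500}\right)$ satisfies \[ \mathsf{CC}(\Pi)\ \ge\ \exp\left(\frac{\varepsilon^2 m}{500}\right). \] -/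

import Mathlib

open scoped ENNReal

noncomputable section

namespace CombAuction

open MeasureTheory

/-- A valuation function on subsets of the `m` items. -/
abbrev Valuation (m : ℕ) := Finset (Fin m) → ℝ

/-- The class of Binary-XOS valuations on `m` items: `v S = max_{C ∈ 𝒞} |S ∩ C|` for some
(nonempty) collection `𝒞` of sets of items. -/
def BXOS (m : ℕ) : Set (Valuation m) :=
  {v | ∃ (𝒞 : Finset (Finset (Fin m))) (h : 𝒞.Nonempty),
    ∀ S, v S = ((𝒞.sup' h fun C => (S ∩ C).card : ℕ) : ℝ)}

/-- The optimal welfare: the maximum of `vA SA + vB SB` over disjoint `SA`, `SB`. -/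
def opt {m : ℕ} (vA vB : Valuation m) : ℝ :=
  (Finset.univ.filter fun S : Finset (Fin m) × Finset (Fin m) => Disjoint S.1 S.2).sup'
    ⟨(∅, ∅), by simp⟩ fun S => vA S.1 + vB S.2

/-- Messages are finite bit strings. -/
abbrev Message := List Bool

/-- Transcripts are finite sequences of messages, in chronological order. -/
abbrev Transcript := List Message

/-- A deterministic two-bidder protocol for valuations in `V` on `m` items. The seller's value
`none` means that `⊥` is sent to both bidders, which ends the communication. -/
structure Protocol (m : ℕ) (V : Set (Valuation m)) where
  /-- Alice's next message, given her valuation and what the seller has sent her so far. -/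
  alice : V → Transcript → Message
  /-- Bob's next message, given his valuation and what the seller has sent him so far. -/
  bob : V → Transcript → Message
  /-- The seller's next messages, given what Alice and Bob have sent so far. -/
  seller : Transcript → Transcript → Option (Message × Message)
  /-- The final allocation, given everything that Alice and Bob have sent. -/
  alloc : Transcript → Transcript → Finset (Fin m) × Finset (Fin m)
  alloc_disjoint : ∀ s t, Disjoint (alloc s t).1 (alloc s t).2
  /-- The final prices, given everything that Alice and Bob have sent. -/
  price : Transcript → Transcript → ℝ × ℝ

/-- All messages exchanged so far in an execution. -/
structure History where
  /-- Messages from Alice to the seller. -/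
  aliceToSeller : Transcript
  /-- Messages from Bob to the seller. -/
  bobToSeller : Transcript
  /-- Messages from the seller to Alice. -/
  sellerToAlice : Transcript
  /-- Messages from the seller to Bob. -/
  sellerToBob : Transcript

/-- The total number of bits exchanged. -/
def History.bits (h : History) : ℕ :=
  h.aliceToSeller.flatten.length + h.bobToSeller.flatten.length +
    h.sellerToAlice.flatten.length + h.sellerToBob.flatten.length

namespace Protocol

variable {m : ℕ} {V : Set (Valuation m)}

/-- The first half of a round: both bidders send a message to the seller. -/
def bidderStep (P : Protocol m V) (vA vB : V) (h : History) : History :=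
  { h with
    aliceToSeller := h.aliceToSeller ++ [P.alice vA h.sellerToAlice]
    bobToSeller := h.bobToSeller ++ [P.bob vB h.sellerToBob] }

/-- The second half of a round: the seller answers both bidders, or ends the communication
(`none`). -/
def sellerStep (P : Protocol m V) (h : History) : Option History :=
  (P.seller h.aliceToSeller h.bobToSeller).map fun s =>
    { h with
      sellerToAlice := h.sellerToAlice ++ [s.1]
      sellerToBob := h.sellerToBob ++ [s.2] }

/-- The history after `k` full rounds; `none` if the protocol has terminated after one of the
rounds `1, …, k`. -/
def historyAfter (P : Protocol m V) (vA vB : V) : ℕ → Option History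
  | 0 => some ⟨[], [], [], []⟩
  | k + 1 => (historyAfter P vA vB k).bind fun h => P.sellerStep (P.bidderStep vA vB h)

/-- The execution terminates after round `k + 1` for some `k`. -/
abbrev Terminates (P : Protocol m V) (vA vB : V) : Prop :=
  ∃ k, P.historyAfter vA vB (k + 1) = none

open Classical in
/-- The number of rounds of the execution; `⊤` if it does not terminate. -/
def rounds (P : Protocol m V) (vA vB : V) : ℕ∞ :=
  if h : P.Terminates vA vB then ((Nat.find h + 1 : ℕ) : ℕ∞) else ⊤

open Classical in
/-- The complete history of a terminating execution: if it terminates after round `k + 1`, this is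
the history of the first `k` rounds together with the bidders' messages of round `k + 1`. It is
`none` if the execution does not terminate. -/
def finalHistory (P : Protocol m V) (vA vB : V) : Option History :=
  if h : P.Terminates vA vB then
    (P.historyAfter vA vB (Nat.find h)).map (P.bidderStep vA vB)
  else none

/-- The allocation made at the end of the execution (`none` if it does not terminate). -/
def allocation (P : Protocol m V) (vA vB : V) : Option (Finset (Fin m) × Finset (Fin m)) :=
  (P.finalHistory vA vB).map fun h => P.alloc h.aliceToSeller h.bobToSeller

/-- The number of bits exchanged in the execution; `⊤` if it does not terminate. -/
def ccOn (P : Protocol m V) (vA vB : V) : ℕ∞ :=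
  match P.finalHistory vA vB with
  | some h => (h.bits : ℕ∞)
  | none => ⊤

/-- The communication complexity: the worst case over the inputs. -/
def cc (P : Protocol m V) : ℕ∞ :=
  ⨆ (vA : V) (vB : V), P.ccOn vA vB

/-- The protocol has exactly one round on all inputs. -/
def IsSimultaneous (P : Protocol m V) : Prop :=
  ∀ vA vB : V, P.rounds vA vB = 1

/-- On input `vA, vB` the protocol terminates with an allocation whose welfare is at least `α`
times the optimal welfare. -/
def AchievesOn (P : Protocol m V) (α : ℝ) (vA vB : V) : Prop :=
  ∃ O ∈ P.allocation vA vB, α * opt vA.1 vB.1 ≤ vA.1 O.1 + vB.1 O.2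

/-- The coarsest σ-algebra on deterministic protocols for which each single value of each of the
five functions is a measurable function of the protocol. -/
instance : MeasurableSpace (Protocol m V) :=
  (⨆ (v : V) (s : Transcript), MeasurableSpace.comap (fun P => P.alice v s) ⊤) ⊔
  (⨆ (v : V) (s : Transcript), MeasurableSpace.comap (fun P => P.bob v s) ⊤) ⊔
  (⨆ (s : Transcript) (t : Transcript), MeasurableSpace.comap (fun P => P.seller s t) ⊤) ⊔
  (⨆ (s : Transcript) (t : Transcript), MeasurableSpace.comap (fun P => P.alloc s t) ⊤) ⊔
  (⨆ (s : Transcript) (t : Transcript),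
    MeasurableSpace.comap (fun P => P.price s t) inferInstance)

end Protocol

/-- A randomized protocol: a probability distribution over deterministic protocols (an arbitrary
one, not necessarily with countable support). -/
structure RandomizedProtocol (m : ℕ) (V : Set (Valuation m)) where
  /-- The distribution of the deterministic protocol. -/
  law : Measure (Protocol m V)
  isProbabilityMeasure_law : IsProbabilityMeasure law

namespace RandomizedProtocol

variable {m : ℕ} {V : Set (Valuation m)}

/-- Almost every deterministic protocol (for a discrete distribution: every one in the support)
is simultaneous. -/
def IsSimultaneous (R : RandomizedProtocol m V) : Prop :=
  ∀ᵐ P ∂(R.law), P.IsSimultaneous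

/-- The communication complexity: the essential supremum of the communication complexities of the
deterministic protocols (for a discrete distribution: the supremum over its support). -/
def cc (R : RandomizedProtocol m V) : ℕ∞ :=
  essSup (fun P : Protocol m V => P.cc) R.law

/-- On every input, an `α`-fraction of the optimal welfare is achieved with probability at least
`p` over the choice of the deterministic protocol. -/
def IsApproxWithProb (R : RandomizedProtocol m V) (α p : ℝ) : Prop :=
  ∀ vA vB : V, p ≤ R.law.real {P | P.AchievesOn α vA vB}

end RandomizedProtocol

end CombAuction

end

/-! Hard inputs: each item draws one of twenty types, which gives it a sign for each bidder and each
of two groups of clauses. Given the types, each bidder has `n` independent ordinary clauses per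
group, containing an item with probability 2/3 or 1/3 according to its sign. A hidden state per item
defines in each group a hidden clause of Alice, and Bob's is its complement. In scenario `θ`, the
clause of each bidder in group `θ` at a random position `i` is replaced by the hidden one. The two
hidden clauses partition the items, so the optimum is at least `m`.

The tables have three properties, checked by finite computation. (1) For each bidder, the signs and
both hidden clauses jointly have the law of the signs and one ordinary clause per group
(`card_hiddenView`). A message with few values depends little on a typical one of many independent
clauses (`sum_expect_influence_le`), so it hardly shows a hidden clause. (2) Two ordinary clauses,
or a hidden clause and an opposing ordinary one of the other group, cover on average less than a
fraction 179/240 of the items. Success in scenario `θ` thus needs clauses of group `θ`, at least one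
of them hidden. (3) If hidden clauses are replaced by their means given the types, and each group
uses at least one, then even giving each item to the better bidder yields on average at most 2 ·
179/240 per item for both groups together (`sum_max_weight_le`).

Both scenarios are compared with a hybrid in which both groups contain their hidden clauses. Being
good for group `θ` does not involve the ordinary clauses of the other group, so by (1) its
probability hardly changes between scenario `θ` and the hybrid. Again by (1), the hybrid allocation
behaves like one computed from ordinary clauses only, which is independent of the hidden states
given the types. This justifies the means in (3), so one allocation is rarely good for both groups.
Hence the two success probabilities sum to at most 1 plus an exponentially small error, also after
averaging over the randomized protocol. -/

noncomputable section

namespace CombAuction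

open Finset MeasureTheory
open scoped BigOperators

/-! ### Uniform averages and resampling -/

section Expectation

variable {ι κ α β : Type*} [Fintype ι] [Fintype κ] [Fintype α] [Fintype β]

theorem expect_prod (F : α × β → ℝ) : 𝔼 x, F x = 𝔼 a, 𝔼 b, F (a, b) := by
  rw [← univ_product_univ, expect_product]

theorem expect_fst [Nonempty β] (F : α → ℝ) : 𝔼 x : α × β, F x.1 = 𝔼 a, F a := by
  rw [expect_prod]; simp

theorem expect_mono {F G : α → ℝ} (h : ∀ a, F a ≤ G a) : 𝔼 a, F a ≤ 𝔼 a, G a :=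
  expect_le_expect fun a _ => h a

/-- Resampling one coordinate of a uniformly random function does not change its law. -/
theorem expect_update [DecidableEq ι] [Nonempty α] (i : ι) (G : (ι → α) → ℝ) :
    𝔼 f : ι → α, 𝔼 a, G (Function.update f i a) = 𝔼 f, G f := by
  rw [← expect_prod (fun x : (ι → α) × α => G (Function.update x.1 i x.2)),
    ← expect_fst (β := α) G]
  -- Exchanging the fresh value with the old coordinate is an involution.
  refine Fintype.expect_bijective (fun x => (Function.update x.1 i x.2, x.1 i)) ?_ _ _
    fun _ => rfl
  refine Function.Involutive.bijective fun x => ?_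
  simp

/-- The marginals of a uniformly random function are uniform. -/
theorem expect_comp_injective [DecidableEq ι] [DecidableEq κ] [Nonempty α] {e : κ → ι}
    (he : e.Injective)
    (G : (κ → α) → ℝ) : 𝔼 f : ι → α, G (f ∘ e) = 𝔼 g, G g := by
  classical
  have h1 : 𝔼 f : ι → α, G (f ∘ e) =
      𝔼 x : ({i // i ∈ Set.range e} → α) × ({i // i ∉ Set.range e} → α),
        G (fun k => x.1 ⟨e k, k, rfl⟩) :=
    Fintype.expect_equiv (Equiv.piEquivPiSubtypeProd (· ∈ Set.range e) fun _ => α) _ _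
      fun f => rfl
  rw [h1, expect_fst (fun g : {i // i ∈ Set.range e} → α => G (fun k => g ⟨e k, k, rfl⟩))]
  exact Fintype.expect_equiv ((Equiv.ofInjective e he).arrowCongr (Equiv.refl α)).symm _ _
    fun f => rfl

end Expectation

/-! ### Uniform probability and union bounds -/

section Probability

open Classical in
/-- The probability of an event under the uniform distribution. -/
def prob {Ω : Type*} [Fintype Ω] (P : Ω → Prop) : ℝ := 𝔼 ω, if P ω then 1 else 0

variable {Ω : Type*} [Fintype Ω]

theorem prob_mono {P Q : Ω → Prop} (h : ∀ ω, P ω → Q ω) : prob P ≤ prob Q := by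
  refine expect_mono fun ω => ?_
  by_cases hP : P ω
  · simp [hP, h ω hP]
  · simp only [hP, if_false]; split_ifs <;> norm_num

theorem prob_or_le (P Q : Ω → Prop) : prob (fun ω => P ω ∨ Q ω) ≤ prob P + prob Q := by
  rw [prob, prob, prob, ← expect_add_distrib]
  refine expect_mono fun ω => ?_
  by_cases hP : P ω <;> by_cases hQ : Q ω <;> simp [hP, hQ]

theorem prob_exists_le {ι : Type*} [Fintype ι] (P : ι → Ω → Prop) (δ : ℝ)
    (h : ∀ i, prob (P i) ≤ δ) : prob (fun ω => ∃ i, P i ω) ≤ Fintype.card ι * δ := by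
  classical
  calc prob (fun ω => ∃ i, P i ω) ≤ ∑ i, prob (P i) := by
        simp only [prob]
        rw [← expect_sum_comm]
        refine expect_mono fun ω => ?_
        by_cases hP : ∃ i, P i ω
        · obtain ⟨i, hi⟩ := hP
          rw [if_pos ⟨i, hi⟩]
          refine le_trans (by simp [hi]) (single_le_sum (f := fun i => if P i ω then (1 : ℝ) else 0)
            (fun j _ => by split_ifs <;> norm_num) (mem_univ i))
        · rw [if_neg hP]
          exact sum_nonneg fun j _ => by split_ifs <;> norm_num
    _ ≤ ∑ _i : ι, δ := sum_le_sum fun i _ => h i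
    _ = _ := by simp

theorem expect_one_sub_prob [Nonempty Ω] (P : Ω → Prop) : prob (fun ω => ¬ P ω) = 1 - prob P := by
  rw [prob, prob, ← Fintype.expect_one (ι := Ω), ← expect_sub_distrib]
  refine expect_congr rfl fun ω _ => ?_
  by_cases hP : P ω <;> simp [hP]

theorem prob_prod {Ω' : Type*} [Fintype Ω'] (P : Ω × Ω' → Prop) :
    prob P = 𝔼 ω, prob (fun ω' => P (ω, ω')) := expect_prod _

end Probability

/-! ### Exponential moments and Hoeffding's inequality -/

section Concentration

variable {ι L : Type*} [Fintype ι] [Fintype L]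

theorem expect_pi_prod [DecidableEq ι] (F : ι → L → ℝ) :
    𝔼 l : ι → L, ∏ e, F e (l e) = ∏ e, 𝔼 a, F e a := by
  simp only [Fintype.expect_eq_sum_div_card]
  rw [prod_div_distrib, Fintype.card_fun, prod_const, card_univ, prod_univ_sum,
    Fintype.piFinset_univ]
  push_cast
  rfl

/-- Independence reduces this to one coordinate, where convexity puts `exp` below its chord on `[-R,
R]`. The mean being nonpositive leaves `cosh (lam * R)`. -/
theorem expect_exp_sum_le [DecidableEq ι] [Nonempty L] (F : ι → L → ℝ) {R : ℝ} (hR : 0 < R)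
    (hF : ∀ e a, |F e a| ≤ R) (hF0 : ∀ e, 𝔼 a, F e a ≤ 0) {lam : ℝ} (hlam : 0 ≤ lam) :
    𝔼 l : ι → L, Real.exp (lam * ∑ e, F e (l e)) ≤
      Real.exp (Fintype.card ι * ((lam * R) ^ 2 / 2)) := by
  have h1 : ∀ e, 𝔼 a, Real.exp (lam * F e a) ≤ Real.exp ((lam * R) ^ 2 / 2) := fun e => by
    calc 𝔼 a, Real.exp (lam * F e a)
        ≤ 𝔼 a, (Real.cosh (lam * R) + F e a * (Real.sinh (lam * R) / R)) := by
          refine expect_mono fun a => ?_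
          have := Real.exp_mul_le_cosh_add_mul_sinh (t := F e a / R)
            (by rw [abs_div, abs_of_pos hR]; exact (div_le_one hR).2 (hF e a)) (lam * R)
          calc Real.exp (lam * F e a) = Real.exp (F e a / R * (lam * R)) := by
                congr 1; field_simp
            _ ≤ _ := this
            _ = _ := by ring
      _ = Real.cosh (lam * R) + (𝔼 a, F e a) * (Real.sinh (lam * R) / R) := by
          rw [expect_add_distrib, Fintype.expect_const, expect_mul]
      _ ≤ Real.cosh (lam * R) := by
          have : 0 ≤ Real.sinh (lam * R) / R :=
            div_nonneg (Real.sinh_nonneg_iff.2 (by positivity)) hR.le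
          nlinarith [hF0 e, mul_nonneg this (neg_nonneg.2 (hF0 e))]
      _ ≤ _ := Real.cosh_le_exp_half_sq _
  calc 𝔼 l : ι → L, Real.exp (lam * ∑ e, F e (l e))
      = 𝔼 l : ι → L, ∏ e, Real.exp (lam * F e (l e)) := by
        simp only [mul_sum, Real.exp_sum]
    _ = ∏ e, 𝔼 a, Real.exp (lam * F e a) := expect_pi_prod fun e a => Real.exp (lam * F e a)
    _ ≤ ∏ _e : ι, Real.exp ((lam * R) ^ 2 / 2) :=
        prod_le_prod (fun e _ => expect_nonneg fun a _ => (Real.exp_pos _).le) fun e _ => h1 e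
    _ = _ := by rw [prod_const, card_univ, ← Real.exp_nat_mul]

/-- Hoeffding's inequality, with a non-optimal constant. -/
theorem prob_sum_ge_le [DecidableEq ι] [Nonempty L] (F : ι → L → ℝ) {R : ℝ} (hR : 0 < R)
    (hF : ∀ e a, |F e a| ≤ R) (hF0 : ∀ e, 𝔼 a, F e a ≤ 0) {η : ℝ} (hη : 0 ≤ η) :
    prob (fun l : ι → L => η * Fintype.card ι ≤ ∑ e, F e (l e)) ≤
      Real.exp (-(η ^ 2 * Fintype.card ι / (2 * R ^ 2))) := by
  set lam := η / R ^ 2 with hlam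
  have hlam0 : 0 ≤ lam := by positivity
  calc prob (fun l : ι → L => η * Fintype.card ι ≤ ∑ e, F e (l e))
      ≤ 𝔼 l : ι → L, Real.exp (lam * ∑ e, F e (l e)) *
          Real.exp (-(lam * (η * Fintype.card ι))) := by
        refine expect_mono fun l => ?_
        split_ifs with h
        · rw [← Real.exp_add, Real.one_le_exp_iff]
          nlinarith [mul_le_mul_of_nonneg_left h hlam0]
        · positivity
    _ ≤ Real.exp (Fintype.card ι * ((lam * R) ^ 2 / 2)) *
          Real.exp (-(lam * (η * Fintype.card ι))) := by
        rw [← expect_mul]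
        exact mul_le_mul_of_nonneg_right (expect_exp_sum_le F hR hF hF0 hlam0) (Real.exp_pos _).le
    _ = _ := by
        rw [← Real.exp_add, hlam]
        congr 1
        field_simp
        ring

end Concentration

/-! ### Short messages reveal little about a single clause -/

section Hiding

variable {n : ℕ} {Sd W M : Type*} [Fintype Sd] [Fintype M] [DecidableEq M]

/-- How much the law of the message `f` moves (in total variation) when the `i`-th of the random
clauses `d (s 0), …, d (s (n - 1))` is replaced by `w`. -/
def influence (d : Sd → W) (f : (Fin n → W) → M) (i : Fin n) (w : W) : ℝ :=
  ∑ μ, max 0 ((𝔼 s : Fin n → Sd, if f (Function.update (d ∘ s) i w) = μ then (1 : ℝ) else 0) -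
    𝔼 s : Fin n → Sd, if f (d ∘ s) = μ then (1 : ℝ) else 0)

theorem expect_eq_sum_mul {A : Type*} [Fintype A] (f : A → M) (F : M → ℝ) :
    𝔼 s, F (f s) = ∑ μ, F μ * 𝔼 s, if f s = μ then (1 : ℝ) else 0 := by
  simp_rw [mul_expect]
  rw [← expect_sum_comm]
  refine expect_congr rfl fun s _ => ?_
  simp

theorem expect_sub_le_influence (d : Sd → W) (f : (Fin n → W) → M) (i : Fin n) (w : W)
    (F : M → ℝ) (hF0 : ∀ μ, 0 ≤ F μ) (hF1 : ∀ μ, F μ ≤ 1) :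
    (𝔼 s : Fin n → Sd, F (f (Function.update (d ∘ s) i w))) - 𝔼 s : Fin n → Sd, F (f (d ∘ s)) ≤
      influence d f i w := by
  rw [expect_eq_sum_mul (fun s : Fin n → Sd => f (Function.update (d ∘ s) i w)),
    expect_eq_sum_mul (fun s : Fin n → Sd => f (d ∘ s)), ← sum_sub_distrib]
  refine sum_le_sum fun μ _ => ?_
  rw [← mul_sub]
  set x := (𝔼 s : Fin n → Sd, if f (Function.update (d ∘ s) i w) = μ then (1 : ℝ) else 0) -
    𝔼 s : Fin n → Sd, if f (d ∘ s) = μ then (1 : ℝ) else 0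
  rcases le_total 0 x with hx | hx
  · rw [max_eq_right hx]; nlinarith [hF1 μ]
  · rw [max_eq_left hx]; nlinarith [hF0 μ]

/-- The total variation distance is attained by the test that accepts the messages made more likely
by the replacement. -/
theorem exists_test (d : Sd → W) (f : (Fin n → W) → M) :
    ∃ T : Fin n → W → M → ℝ, (∀ i w μ, 0 ≤ T i w μ ∧ T i w μ ≤ 1) ∧
      ∀ i w, influence d f i w = (𝔼 s : Fin n → Sd, T i w (f (Function.update (d ∘ s) i w))) -
        𝔼 s : Fin n → Sd, T i w (f (d ∘ s)) := by
  obtain ⟨c, hc⟩ : ∃ c : Fin n → W → M → ℝ, ∀ i w μ, c i w μ =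
      (𝔼 s : Fin n → Sd, if f (Function.update (d ∘ s) i w) = μ then (1 : ℝ) else 0) -
        𝔼 s : Fin n → Sd, if f (d ∘ s) = μ then (1 : ℝ) else 0 := ⟨_, fun _ _ _ => rfl⟩
  obtain ⟨T, hT⟩ : ∃ T : Fin n → W → M → ℝ, ∀ i w μ, T i w μ = if 0 ≤ c i w μ then 1 else 0 :=
    ⟨_, fun _ _ _ => rfl⟩
  refine ⟨T, fun i w μ => ?_, fun i w => ?_⟩
  · rw [hT]; split_ifs <;> norm_num
  · rw [expect_eq_sum_mul (fun s : Fin n → Sd => f (Function.update (d ∘ s) i w)),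
      expect_eq_sum_mul (fun s : Fin n → Sd => f (d ∘ s)), ← sum_sub_distrib, influence]
    refine sum_congr rfl fun μ _ => ?_
    rw [← mul_sub, ← hc, hT]
    split_ifs with h
    · rw [max_eq_right h, one_mul]
    · rw [max_eq_left (not_le.1 h).le, zero_mul]

/-- A message with few values cannot depend much on a typical one of many independent clauses. -/
theorem sum_expect_influence_le [Nonempty Sd] [Nonempty M] (d : Sd → W) (f : (Fin n → W) → M)
    {lam : ℝ} (hlam : 0 < lam) :
    ∑ i, 𝔼 a, influence d f i (d a) ≤ Real.log (Fintype.card M) / lam + n * lam / 2 := by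
  obtain ⟨T, hT, hTi⟩ := exists_test d f
  set τ : Fin n → M → ℝ := fun i μ => 𝔼 a, T i (d a) μ with hτ
  have hτ0 : ∀ i μ, 0 ≤ τ i μ := fun i μ => expect_nonneg fun a _ => (hT i (d a) μ).1
  have hτ1 : ∀ i μ, τ i μ ≤ 1 := fun i μ => expect_le univ_nonempty fun a _ => (hT i (d a) μ).2
  set Y : (Fin n → Sd) → M → ℝ := fun s μ => ∑ i, (T i (d (s i)) μ - τ i μ) with hY
  -- Inserting a fresh clause at `i` amounts to testing the clause already there, while testing a
  -- fresh clause against an unchanged message averages to `τ`.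
  have h1 : ∑ i, 𝔼 a, influence d f i (d a) = 𝔼 s : Fin n → Sd, Y s (f (d ∘ s)) := by
    rw [hY, expect_sum_comm]
    refine sum_congr rfl fun i _ => ?_
    simp only [hTi]
    rw [expect_sub_distrib, expect_sub_distrib]
    congr 1
    · rw [expect_comm, ← expect_update i (fun s => T i (d (s i)) (f (d ∘ s)))]
      refine expect_congr rfl fun s _ => expect_congr rfl fun a _ => ?_
      rw [Function.update_self, Function.comp_update]
    · rw [expect_comm]
  set c := Real.log (Fintype.card M) / lam + n * lam / 2 with hc
  -- Tangent line form of Jensen's inequality; `c` is chosen so that the exponential moment in `h4`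
  -- is at most `exp (lam * c)`.
  have h2 : ∀ s μ, Y s μ ≤ c + (Real.exp (lam * Y s μ) * Real.exp (-(lam * c)) - 1) / lam := by
    intro s μ
    have h := Real.add_one_le_exp (lam * Y s μ - lam * c)
    rw [sub_eq_add_neg (lam * Y s μ), Real.exp_add] at h
    have : Y s μ - c ≤ (Real.exp (lam * Y s μ) * Real.exp (-(lam * c)) - 1) / lam := by
      rw [le_div_iff₀ hlam]; linarith
    linarith
  have h3 : ∀ μ, 𝔼 s : Fin n → Sd, Real.exp (lam * Y s μ) ≤ Real.exp (n * (lam ^ 2 / 2)) := by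
    intro μ
    have := expect_exp_sum_le (fun i a => T i (d a) μ - τ i μ) (R := 1) one_pos (fun i a => by
      rw [abs_le]; constructor <;> linarith [hτ0 i μ, hτ1 i μ, (hT i (d a) μ).1, (hT i (d a) μ).2])
      (fun i => by rw [expect_sub_distrib, Fintype.expect_const]; simp [hτ]) hlam.le
    simpa [hY] using this
  have hK : (0 : ℝ) < Fintype.card M := by exact_mod_cast Fintype.card_pos
  -- The message depends on `s`, so it is replaced by a sum over all messages, at the cost of the
  -- factor `Fintype.card M`.
  have h4 : 𝔼 s : Fin n → Sd, Real.exp (lam * Y s (f (d ∘ s))) ≤ Real.exp (lam * c) := by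
    calc 𝔼 s : Fin n → Sd, Real.exp (lam * Y s (f (d ∘ s)))
        ≤ 𝔼 s : Fin n → Sd, ∑ μ, Real.exp (lam * Y s μ) :=
          expect_mono fun s => single_le_sum (f := fun μ => Real.exp (lam * Y s μ))
            (fun μ _ => (Real.exp_pos _).le) (mem_univ (f (d ∘ s)))
      _ = ∑ μ, 𝔼 s : Fin n → Sd, Real.exp (lam * Y s μ) := expect_sum_comm _ _ _
      _ ≤ ∑ _μ : M, Real.exp (n * (lam ^ 2 / 2)) := sum_le_sum fun μ _ => h3 μ
      _ = Real.exp (lam * c) := by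
          have h5 : lam * c = Real.log (Fintype.card M) + n * (lam ^ 2 / 2) := by
            rw [hc]; field_simp
          rw [sum_const, card_univ, nsmul_eq_mul, h5, Real.exp_add, Real.exp_log hK]
  rw [h1]
  calc 𝔼 s : Fin n → Sd, Y s (f (d ∘ s))
      ≤ 𝔼 s : Fin n → Sd,
          (c + (Real.exp (lam * Y s (f (d ∘ s))) * Real.exp (-(lam * c)) - 1) / lam) :=
        expect_mono fun s => h2 s _
    _ = c + ((𝔼 s : Fin n → Sd, Real.exp (lam * Y s (f (d ∘ s)))) * Real.exp (-(lam * c)) - 1) /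
          lam := by
        rw [expect_add_distrib, Fintype.expect_const, ← expect_div, expect_sub_distrib,
          ← expect_mul, Fintype.expect_const]
    _ ≤ c + (Real.exp (lam * c) * Real.exp (-(lam * c)) - 1) / lam := by gcongr
    _ = c := by rw [← Real.exp_add]; simp

end Hiding

/-! ### The law of a single item and its finite checks -/

section LocalLaw

/-- The signs of the twenty equally likely types of an item: those of Alice for the two groups of
clauses, followed by those of Bob. -/
def signTable : Fin 20 → (Bool × Bool) × (Bool × Bool) :=
  ![((true, true), (false, true)), ((true, false), (false, false)),
    ((true, true), (true, false)), ((false, true), (false, false)),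
    ((false, false), (true, false)), ((false, true), (true, true)),
    ((false, false), (false, true)), ((true, false), (true, true)),
    ((true, true), (true, true)), ((true, true), (true, true)),
    ((false, false), (false, false)), ((false, false), (false, false)),
    ((true, false), (false, true)), ((true, false), (false, true)),
    ((false, true), (true, false)), ((false, true), (true, false)),
    ((true, false), (true, false)), ((true, false), (true, false)),
    ((false, true), (false, true)), ((false, true), (false, true))]

/-- For each type, the numbers of the eighteen hidden states in which the hidden clauses of Alice
contain the item in both groups, only in the first, only in the second. -/
def hiddenTable : Fin 20 → ℕ × ℕ × ℕ :=
  ![(12, 6, 0), (12, 6, 0), (12, 0, 6), (12, 0, 6), (0, 0, 6), (0, 0, 6),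
    (0, 6, 0), (0, 6, 0), (4, 5, 5), (4, 5, 5), (4, 5, 5), (4, 5, 5),
    (0, 15, 3), (0, 15, 3), (0, 3, 15), (0, 3, 15), (6, 3, 3), (6, 3, 3),
    (6, 3, 3), (6, 3, 3)]

/-- The sign of bidder `p` (`false` is Alice) for the group `g` at an item of type `t`. -/
def sign (p g : Bool) (t : Fin 20) : Bool :=
  let x := if p then (signTable t).2 else (signTable t).1
  if g then x.2 else x.1

/-- Membership of an item of sign `b` in an ordinary clause: probability `2 / 3` for a positive
sign and `1 / 3` for a negative one. -/
def member (b : Bool) (z : Fin 3) : Bool := b != (z == 0)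

/-- Membership of an item in the hidden clause of bidder `p` in group `g`; those of Bob are the
complements of those of Alice. -/
def hiddenMember (p g : Bool) (t : Fin 20) (u : Fin 18) : Bool :=
  let c := hiddenTable t
  p != if g then (decide (u.1 < c.1) ||
      (decide (c.1 + c.2.1 ≤ u.1) && decide (u.1 < c.1 + c.2.1 + c.2.2)))
    else decide (u.1 < c.1 + c.2.1)

/-- The number of hidden states in which the hidden clause contains an item of type `t`. -/
def hiddenCount (p g : Bool) (t : Fin 20) : ℕ :=
  (univ.filter fun u => hiddenMember p g t u = true).card

theorem hiddenMember_not (p g : Bool) (t : Fin 20) (u : Fin 18) :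
    hiddenMember (!p) g t u = !hiddenMember p g t u := by
  cases p <;> simp [hiddenMember]

/-- Signs and hidden memberships of bidder `p`. -/
def hiddenView (p : Bool) (x : Fin 20 × Fin 18) : (Bool × Bool) × (Bool × Bool) :=
  ((sign p false x.1, sign p true x.1),
    (hiddenMember p false x.1 x.2, hiddenMember p true x.1 x.2))

/-- Signs and ordinary memberships of bidder `p`. -/
def ordinaryView (p : Bool) (x : Fin 20 × (Fin 3 × Fin 3)) : (Bool × Bool) × (Bool × Bool) :=
  ((sign p false x.1, sign p true x.1),
    (member (sign p false x.1) x.2.1, member (sign p true x.1) x.2.2))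

/-- The indistinguishability of hidden and ordinary clauses for one bidder; the factor 2 is the
ratio of the sample sizes 20 · 18 and 20 · 9. -/
theorem card_hiddenView (p : Bool) (v : (Bool × Bool) × (Bool × Bool)) :
    (univ.filter fun x => hiddenView p x = v).card =
      2 * (univ.filter fun x => ordinaryView p x = v).card := by
  revert p v
  decide +kernel

/-- The mean coverage is 134/180 = 67/90, below 179/240; the next lemma gives the same ratio
804/1080. -/
theorem sum_member_or_member (g h : Bool) :
    ∑ t, ∑ y, ∑ z, (member (sign false g t) y || member (sign true h t) z).toNat = 134 := by
  revert g h
  decide +kernel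

theorem sum_member_or_hiddenMember (p g : Bool) :
    ∑ t, ∑ u, ∑ z, (member (sign p g t) z || hiddenMember (!p) (!g) t u).toNat = 804 := by
  revert p g
  decide +kernel

/-- Eighteen times the membership in an ordinary clause, or eighteen times the probability of
membership in the hidden clause. -/
def weight (hidden p g : Bool) (t : Fin 20) (z : Fin 3) : ℕ :=
  if hidden then hiddenCount p g t else 18 * (member (sign p g t) z).toNat

/-- A closed form that spares the kernel the filtered cardinalities in the large check below. -/
theorem hiddenCount_eq (p g : Bool) (t : Fin 20) : hiddenCount p g t =
    (let c := hiddenTable t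
     let a := if g then c.1 + c.2.2 else c.1 + c.2.1
     if p then 18 - a else a) := by
  revert p g t
  decide +kernel

/-- This fixes the constant of the theorem: 43497 = 2 · (179/240) · 18 · 20 · 81, where 18 scales
the weights and 20 · 81 counts the terms. -/
theorem sum_max_weight_le (a b c d : Bool) (h : a || b) (h' : c || d) :
    ∑ t, ∑ x, ∑ x', ∑ y, ∑ y',
      max (weight a false false t x + weight c false true t x')
        (weight b true false t y + weight d true true t y') ≤ 43497 := by
  revert a b c d
  simp only [weight, hiddenCount_eq]
  decide +kernel

end LocalLaw

/-! ### Product laws with equal marginals -/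

section Laws

theorem expect_eval {ι α : Type*} [Fintype ι] [DecidableEq ι] [Fintype α] [Nonempty α] (i : ι)
    (G : α → ℝ) : 𝔼 f : ι → α, G (f i) = 𝔼 a, G a := by
  rw [← expect_update i (fun f => G (f i))]
  simp

theorem expect_arrow_prod {ι α β : Type*} [Fintype ι] [DecidableEq ι] [Fintype α] [Fintype β]
    (G : (ι → α × β) → ℝ) :
    𝔼 l, G l = 𝔼 a : ι → α, 𝔼 b : ι → β, G (fun e => (a e, b e)) := by
  rw [← expect_prod (fun x : (ι → α) × (ι → β) => G (fun e => (x.1 e, x.2 e)))]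
  exact Fintype.expect_equiv (Equiv.arrowProdEquivProdArrow ι (fun _ => α) (fun _ => β)) _ _
    fun _ => rfl

/-- The function on `Bool` with value `a` at `g` and `b` elsewhere. -/
def atOr {α : Type*} (g : Bool) (a b : α) : Bool → α := fun g' => if g' = g then a else b

theorem atOr_self {α : Type*} (g : Bool) (a b : α) : atOr g a b g = a := by simp [atOr]

theorem atOr_not {α : Type*} (g : Bool) (a b : α) : atOr g a b (!g) = b := by simp [atOr]

theorem eq_atOr {α : Type*} (g : Bool) (f : Bool → α) : f = atOr g (f g) (f !g) := by
  funext g'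
  cases g <;> cases g' <;> rfl

theorem expect_bool_arrow {α : Type*} [Fintype α] (g : Bool) (G : (Bool → α) → ℝ) :
    𝔼 f, G f = 𝔼 a, 𝔼 b, G (atOr g a b) := by
  rw [← expect_prod (fun x : α × α => G (atOr g x.1 x.2))]
  refine Fintype.expect_bijective (fun f => (f g, f !g)) ⟨fun f f' h => ?_, fun x => ?_⟩ _ _
    fun f => by rw [← eq_atOr]
  · rw [eq_atOr g f, eq_atOr g f']
    simp only [Prod.mk.injEq] at h
    rw [h.1, h.2]
  · exact ⟨atOr g x.1 x.2, by simp [atOr_self, atOr_not]⟩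

theorem ite_comp_eq_prod {ι A Z : Type*} [Fintype ι] [DecidableEq Z] (χ : A → Z) (l : ι → A)
    (z : ι → Z) :
    (if χ ∘ l = z then (1 : ℝ) else 0) = ∏ e, if χ (l e) = z e then (1 : ℝ) else 0 := by
  by_cases hl : χ ∘ l = z
  · rw [if_pos hl, prod_eq_one]
    exact fun e _ => if_pos (congrFun hl e)
  · rw [if_neg hl]
    obtain ⟨e, he⟩ := Function.ne_iff.1 hl
    exact (prod_eq_zero (mem_univ e) (if_neg he)).symm

/-- Independent coordinates with equal one-coordinate laws have equal joint laws; `h` is that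
equality with denominators cleared. -/
theorem expect_comp_eq_of_card {ι L L' Z : Type*} [Fintype ι] [DecidableEq ι] [Fintype L]
    [Fintype L'] [Fintype Z] [DecidableEq Z] (φ : L → Z) (ψ : L' → Z)
    (h : ∀ z, (univ.filter fun l => φ l = z).card * Fintype.card L' =
      (univ.filter fun l => ψ l = z).card * Fintype.card L) [Nonempty L] [Nonempty L']
    (G : (ι → Z) → ℝ) : 𝔼 l : ι → L, G (φ ∘ l) = 𝔼 l : ι → L', G (ψ ∘ l) := by
  rw [expect_eq_sum_mul (fun l : ι → L => φ ∘ l), expect_eq_sum_mul (fun l : ι → L' => ψ ∘ l)]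
  refine sum_congr rfl fun z _ => ?_
  congr 1
  simp_rw [ite_comp_eq_prod]
  rw [expect_pi_prod (fun e a => if φ a = z e then (1 : ℝ) else 0),
    expect_pi_prod (fun e a => if ψ a = z e then (1 : ℝ) else 0)]
  refine prod_congr rfl fun e _ => ?_
  simp only [Fintype.expect_eq_sum_div_card, sum_boole]
  rw [div_eq_div_iff (by positivity) (by positivity)]
  exact_mod_cast h (z e)

end Laws

/-! ### The random instance -/

section Sample

variable {m n : ℕ}

/-- The types of the items, their hidden states, and the randomness of the ordinary clauses, which
are indexed by a bidder, a group and a number. -/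
abbrev Sample (m n : ℕ) :=
  (Fin m → Fin 20) × (Fin m → Fin 18) × (Bool × Bool → Fin n → Fin m → Fin 3)

/-- A set of items, given by its indicator function. -/
abbrev Items (m : ℕ) := Fin m → Bool

/-- The signs of all items. -/
def signs (t : Fin m → Fin 20) (p g : Bool) : Items m := fun e => sign p g (t e)

/-- The ordinary clause with given signs and randomness. -/
def clauseOf (σ : Items m) (z : Fin m → Fin 3) : Items m := fun e => member (σ e) (z e)

/-- The ordinary clauses. -/
def ordinary (ω : Sample m n) (p g : Bool) : Fin n → Items m :=
  clauseOf (signs ω.1 p g) ∘ ω.2.2 (p, g)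

/-- The hidden clause. -/
def hidden (ω : Sample m n) (p g : Bool) : Items m := fun e => hiddenMember p g (ω.1 e) (ω.2.1 e)

/-- The clauses of bidder `p` when, for the groups with `κ p g`, the `i`-th ordinary clause is
replaced by the hidden one. -/
def clauses (κ : Bool → Bool → Bool) (i : Fin n) (ω : Sample m n) (p g : Bool) : Fin n → Items m :=
  if κ p g then Function.update (ordinary ω p g) i (hidden ω p g) else ordinary ω p g

/-- Replaces the randomness of one group of ordinary clauses. -/
def resample (ω : Sample m n) (x : Bool × Bool) (s : Fin n → Fin m → Fin 3) : Sample m n :=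
  (ω.1, ω.2.1, Function.update ω.2.2 x s)

theorem expect_resample (x : Bool × Bool) (G : Sample m n → ℝ) :
    𝔼 ω : Sample m n, 𝔼 s, G (resample ω x s) = 𝔼 ω, G ω := by
  rw [expect_prod, expect_prod]
  refine expect_congr rfl fun t _ => ?_
  rw [expect_prod, expect_prod]
  refine expect_congr rfl fun u _ => ?_
  exact expect_update x fun r => G (t, u, r)

/-- To one bidder, the hidden clauses of both groups jointly look like ordinary ones. -/
theorem expect_hidden (p : Bool) (x : Bool × Bool)
    (Ψ : (Bool → Items m) → (Bool → Items m) → (Fin n → Fin m → Fin 3) → ℝ) :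
    𝔼 ω : Sample m n, Ψ (signs ω.1 p) (hidden ω p) (ω.2.2 x) =
      𝔼 t : Fin m → Fin 20, 𝔼 z : Bool → Fin m → Fin 3, 𝔼 r,
        Ψ (signs t p) (fun g => clauseOf (signs t p g) (z g)) r := by
  set G : (Fin m → (Bool × Bool) × (Bool × Bool)) → ℝ := fun v =>
    𝔼 r, Ψ (atOr false (fun e => (v e).1.1) (fun e => (v e).1.2))
      (atOr false (fun e => (v e).2.1) (fun e => (v e).2.2)) r with hG
  have h1 : 𝔼 ω : Sample m n, Ψ (signs ω.1 p) (hidden ω p) (ω.2.2 x) =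
      𝔼 l : Fin m → Fin 20 × Fin 18, G (hiddenView p ∘ l) := by
    rw [expect_prod, expect_arrow_prod]
    refine expect_congr rfl fun t _ => ?_
    rw [expect_prod]
    refine expect_congr rfl fun u _ => ?_
    rw [hG]
    refine (expect_eval x fun r =>
      Ψ (signs t p) (fun g e => hiddenMember p g (t e) (u e)) r).trans ?_
    refine expect_congr rfl fun r _ => ?_
    congr 1 <;> exact eq_atOr false _
  have h2 : 𝔼 t : Fin m → Fin 20, 𝔼 z : Bool → Fin m → Fin 3, 𝔼 r,
        Ψ (signs t p) (fun g => clauseOf (signs t p g) (z g)) r =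
      𝔼 l : Fin m → Fin 20 × (Fin 3 × Fin 3), G (ordinaryView p ∘ l) := by
    rw [expect_arrow_prod]
    refine expect_congr rfl fun t _ => ?_
    rw [expect_arrow_prod, expect_bool_arrow false]
    refine expect_congr rfl fun a _ => expect_congr rfl fun b _ => ?_
    rw [hG]
    refine expect_congr rfl fun r _ => ?_
    congr 1 <;> exact eq_atOr false _
  rw [h1, h2]
  refine expect_comp_eq_of_card _ _ (fun v => ?_) G
  rw [card_hiddenView]
  simp only [Fintype.card_prod, Fintype.card_fin]
  ring

end Sample

/-! ### Replacing hidden clauses by ordinary ones -/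

section Swap

variable {m n : ℕ} {M A : Type*}

/-- The outcome when the clauses are those of `κ`. -/
def run (msg : Bool → (Bool → Fin n → Items m) → M) (out : M → M → A) (κ : Bool → Bool → Bool)
    (i : Fin n) (ω : Sample m n) : A :=
  out (msg false (clauses κ i ω false)) (msg true (clauses κ i ω true))

theorem clauses_resample_of_ne (κ : Bool → Bool → Bool) (i : Fin n) (ω : Sample m n)
    {x : Bool × Bool} {p g : Bool} (h : x ≠ (p, g)) (s : Fin n → Fin m → Fin 3) :
    clauses κ i (resample ω x s) p g = clauses κ i ω p g := by
  have : ordinary (resample ω x s) p g = ordinary ω p g := by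
    simp [ordinary, resample, Function.update_of_ne h.symm]
  rw [clauses, clauses, this]
  rfl

theorem clauses_resample_self (κ : Bool → Bool → Bool) (i : Fin n) (ω : Sample m n)
    (p g : Bool) (s : Fin n → Fin m → Fin 3) :
    clauses κ i (resample ω (p, g) s) p g =
      if κ p g then Function.update (clauseOf (signs ω.1 p g) ∘ s) i (hidden ω p g)
      else clauseOf (signs ω.1 p g) ∘ s := by
  have : ordinary (resample ω (p, g) s) p g = clauseOf (signs ω.1 p g) ∘ s := by
    simp [ordinary, resample]
  rw [clauses, this]
  rfl

/-- Combines the messages of bidder `p` and of the other bidder. -/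
def outAt (out : M → M → A) (p : Bool) (μ ν : M) : A := if p then out ν μ else out μ ν

theorem run_eq_outAt (msg : Bool → (Bool → Fin n → Items m) → M) (out : M → M → A)
    (κ : Bool → Bool → Bool) (i : Fin n) (ω : Sample m n) (p : Bool) :
    run msg out κ i ω =
      outAt out p (msg p (clauses κ i ω p)) (msg (!p) (clauses κ i ω !p)) := by
  cases p <;> rfl

/-- Isolates where the resampled block enters: only through the message of bidder `p`, in group `g`.
-/
theorem run_resample (msg : Bool → (Bool → Fin n → Items m) → M) (out : M → M → A)
    (κ : Bool → Bool → Bool) (i : Fin n) (ω : Sample m n) (p g : Bool)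
    (s : Fin n → Fin m → Fin 3) :
    run msg out κ i (resample ω (p, g) s) =
      outAt out p (msg p (atOr g
        (if κ p g then Function.update (clauseOf (signs ω.1 p g) ∘ s) i (hidden ω p g)
          else clauseOf (signs ω.1 p g) ∘ s) (clauses κ i ω p !g)))
        (msg (!p) (clauses κ i ω !p)) := by
  rw [run_eq_outAt (p := p)]
  congr 2
  · rw [eq_atOr g (clauses κ i (resample ω (p, g) s) p), clauses_resample_self,
      clauses_resample_of_ne]
    simp
  · funext g'
    rw [clauses_resample_of_ne]
    simp

/-- The hidden clauses are hardly visible in the messages, even given the ordinary clauses of the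
other group. -/
theorem sum_expect_influence_clauses_le [Fintype M] [DecidableEq M] [Nonempty M]
    (f : (Bool → Fin n → Items m) → M) (κ : Bool → Bool → Bool) (p g : Bool) {lam : ℝ}
    (hlam : 0 < lam) :
    ∑ i, 𝔼 ω : Sample m n, influence (clauseOf (signs ω.1 p g))
        (fun C => f (atOr g C (clauses κ i ω p !g))) i (hidden ω p g) ≤
      Real.log (Fintype.card M) / lam + n * lam / 2 := by
  have key : ∀ i, 𝔼 ω : Sample m n, influence (clauseOf (signs ω.1 p g))
        (fun C => f (atOr g C (clauses κ i ω p !g))) i (hidden ω p g) =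
      𝔼 t : Fin m → Fin 20, 𝔼 r : Fin n → Fin m → Fin 3, 𝔼 a,
        influence (clauseOf (signs t p g))
          (fun C => f (atOr g C (clauseOf (signs t p !g) ∘ r))) i (clauseOf (signs t p g) a) := by
    intro i
    have h := expect_hidden (m := m) (n := n) p (p, !g) fun σ h r =>
      influence (clauseOf (σ g)) (fun C => f (atOr g C (if κ p !g then
        Function.update (clauseOf (σ !g) ∘ r) i (h !g) else clauseOf (σ !g) ∘ r))) i (h g)
    refine h.trans (expect_congr rfl fun t _ => ?_)
    rw [expect_bool_arrow g]
    simp only [atOr_self, atOr_not]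
    cases κ p !g with
    | false =>
      simp only [Bool.false_eq_true, if_false, Fintype.expect_const]
      rw [expect_comm]
    | true =>
      simp only [if_true, ← Function.comp_update]
      rw [expect_comm]
      -- After the change of law, the other group's replacement is a fresh ordinary clause, which
      -- leaves that family independent and uniform.
      have h2 : ∀ a : Fin m → Fin 3, _ := fun a =>
        expect_update i fun r : Fin n → Fin m → Fin 3 => influence (clauseOf (signs t p g))
          (fun C => f (atOr g C (clauseOf (signs t p !g) ∘ r))) i (clauseOf (signs t p g) a)
      rw [expect_comm, expect_comm (s := (univ : Finset (Fin n → Fin m → Fin 3)))]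
      refine expect_congr rfl fun a _ => ?_
      rw [← h2 a, expect_comm]
  simp_rw [key]
  rw [← expect_sum_comm]
  refine expect_le univ_nonempty fun t _ => ?_
  rw [← expect_sum_comm]
  refine expect_le univ_nonempty fun r _ => ?_
  exact sum_expect_influence_le (clauseOf (signs t p g))
    (fun C => f (atOr g C (clauseOf (signs t p !g) ∘ r))) hlam

/-- Replacing a hidden clause by an ordinary one hardly changes the law of the outcome, jointly
with everything but the ordinary clauses of that bidder in that group. -/
theorem sum_expect_run_sub_le [Fintype M] [DecidableEq M] [Nonempty M]
    (msg : Bool → (Bool → Fin n → Items m) → M) (out : M → M → A) (κ κ' : Bool → Bool → Bool)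
    (p g : Bool) (hκ : κ p g = true) (hκ' : κ' p g = false)
    (hκκ : ∀ p' g', (p', g') ≠ (p, g) → κ' p' g' = κ p' g')
    (F : Sample m n → A → ℝ) (hF0 : ∀ ω a, 0 ≤ F ω a) (hF1 : ∀ ω a, F ω a ≤ 1)
    (hF : ∀ ω s a, F (resample ω (p, g) s) a = F ω a) {lam : ℝ} (hlam : 0 < lam) :
    ∑ i, ((𝔼 ω : Sample m n, F ω (run msg out κ i ω)) -
      𝔼 ω : Sample m n, F ω (run msg out κ' i ω)) ≤
      Real.log (Fintype.card M) / lam + n * lam / 2 := by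
  refine le_trans (sum_le_sum fun i _ => ?_)
    (sum_expect_influence_clauses_le (msg p) κ p g hlam)
  rw [← expect_resample (p, g) fun ω => F ω (run msg out κ i ω),
    ← expect_resample (p, g) fun ω => F ω (run msg out κ' i ω), ← expect_sub_distrib]
  refine expect_mono fun ω => ?_
  have h1 : clauses κ' i ω p (!g) = clauses κ i ω p !g := by
    rw [clauses, clauses, hκκ p (!g) (by simp)]
  have h2 : clauses κ' i ω (!p) = clauses κ i ω !p := by
    funext g'
    rw [clauses, clauses, hκκ (!p) g' (by simp)]
  simp only [hF, run_resample, hκ, hκ', h1, h2, Bool.false_eq_true, if_false, if_true]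
  exact expect_sub_le_influence (clauseOf (signs ω.1 p g))
    (fun C => msg p (atOr g C (clauses κ i ω p !g))) i (hidden ω p g)
    (fun μ => F ω (outAt out p μ (msg (!p) (clauses κ i ω !p)))) (fun _ => hF0 _ _)
    fun _ => hF1 _ _

end Swap

/-! ### Events that are unlikely by concentration -/

section Tests

variable {m n : ℕ}

theorem expect_sample_comp {Q : Type*} [Fintype Q] [DecidableEq Q]
    {sel : Q → (Bool × Bool) × Fin n} (hsel : sel.Injective)
    (G : (Fin m → Fin 20) → (Fin m → Fin 18) → (Q → Fin m → Fin 3) → ℝ) :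
    𝔼 ω : Sample m n, G ω.1 ω.2.1 (fun q => ω.2.2 (sel q).1 (sel q).2) =
      𝔼 t, 𝔼 u, 𝔼 c, G t u c := by
  rw [expect_prod]
  refine expect_congr rfl fun t _ => ?_
  rw [expect_prod]
  refine expect_congr rfl fun u _ => ?_
  rw [← expect_comp_injective hsel (G t u)]
  exact Fintype.expect_equiv (Equiv.curry (Bool × Bool) (Fin n) (Fin m → Fin 3)).symm _ _
    fun _ => rfl

/-- The common tail bound for tests on finitely many ordinary clauses. Injectivity of `sel` keeps
the clauses independent given the types, and the items are independent of each other. -/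
theorem prob_sum_sample_ge_le {Q : Type*} [Fintype Q] [DecidableEq Q]
    {sel : Q → (Bool × Bool) × Fin n} (hsel : sel.Injective)
    (φ : Fin 20 → Fin 18 → (Q → Fin 3) → ℝ) {R μ η : ℝ} (hR : 0 < R) (hμ0 : 0 ≤ μ) (hμ : μ ≤ R)
    (hφ0 : ∀ t u c, 0 ≤ φ t u c) (hφ : ∀ t u c, φ t u c ≤ R)
    (hmean : 𝔼 t, 𝔼 u, 𝔼 c, φ t u c ≤ μ) (hη : 0 ≤ η) :
    prob (fun ω : Sample m n => (μ + η) * m ≤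
      ∑ e, φ (ω.1 e) (ω.2.1 e) (fun q => ω.2.2 (sel q).1 (sel q).2 e)) ≤
      Real.exp (-(η ^ 2 * m / (2 * R ^ 2))) := by
  classical
  have h := prob_sum_ge_le (ι := Fin m) (L := (Fin 20 × Fin 18) × (Q → Fin 3))
    (fun _ l => φ l.1.1 l.1.2 l.2 - μ) hR
    (fun _ l => by
      rw [abs_le]; constructor <;> linarith [hφ0 l.1.1 l.1.2 l.2, hφ l.1.1 l.1.2 l.2])
    (fun _ => by
      rw [expect_sub_distrib, Fintype.expect_const, expect_prod, expect_prod]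
      linarith) hη
  rw [Fintype.card_fin] at h
  refine le_trans (le_of_eq ?_) h
  unfold prob
  rw [expect_sample_comp hsel (fun t u c => if (μ + η) * m ≤
    ∑ e, φ (t e) (u e) (fun q => c q e) then 1 else 0), expect_arrow_prod, expect_arrow_prod]
  refine expect_congr rfl fun t _ => expect_congr rfl fun u _ => ?_
  refine Fintype.expect_equiv (Equiv.piComm fun _ _ => Fin 3) _ _ fun c => ?_
  simp only [sum_sub_distrib, sum_const, card_univ, Fintype.card_fin, nsmul_eq_mul]
  refine if_congr ?_ rfl rfl
  change _ ↔ η * (m : ℝ) ≤ ∑ e, φ (t e) (u e) (fun q => c q e) - m * μ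
  constructor <;> intro h <;> linarith

/-- The indicator of a set of items. -/
def ind (C : Items m) (e : Fin m) : ℝ := ((C e).toNat : ℝ)

/-- The total weight of the items that bidder `p` receives when Alice gets `S` and Bob the rest. -/
def gain (p : Bool) (S : Items m) (w : Fin m → ℝ) : ℝ := ∑ e, if S e != p then w e else 0

theorem gain_add_gain_le (S : Items m) (w w' : Fin m → ℝ) :
    gain false S w + gain true S w' ≤ ∑ e, max (w e) (w' e) := by
  rw [gain, gain, ← sum_add_distrib]
  refine sum_le_sum fun e _ => ?_
  cases S e <;> simp

theorem gain_add (p : Bool) (S : Items m) (w w' : Fin m → ℝ) :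
    gain p S (fun e => w e + w' e) = gain p S w + gain p S w' := by
  rw [gain, gain, gain, ← sum_add_distrib]
  refine sum_congr rfl fun e _ => ?_
  split_ifs <;> simp

theorem max_toNat (a b : Bool) : max (a.toNat : ℝ) (b.toNat : ℝ) = ((a || b).toNat : ℝ) := by
  cases a <;> cases b <;> simp

theorem gain_ind_add_gain_ind_le (S C C' : Items m) :
    gain false S (ind C) + gain true S (ind C') ≤ ∑ e, ((C e || C' e).toNat : ℝ) := by
  refine (gain_add_gain_le S _ _).trans (le_of_eq (sum_congr rfl fun e _ => ?_))
  exact max_toNat _ _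

theorem toNat_le_one (a : Bool) : (a.toNat : ℝ) ≤ 1 := by cases a <;> simp

/-- Two ordinary clauses cover too much. -/
def OrdinaryCover (ε : ℝ) (ω : Sample m n) : Prop :=
  ∃ x : (Bool × Bool) × (Fin n × Fin n), (179 / 240 + ε) * m ≤
    ∑ e, ((ordinary ω false x.1.1 x.2.1 e || ordinary ω true x.1.2 x.2.2 e).toNat : ℝ)

/-- An ordinary clause and a hidden one of the other group cover too much. -/
def HiddenCover (ε : ℝ) (ω : Sample m n) : Prop :=
  ∃ x : (Bool × Bool) × Fin n, (179 / 240 + ε) * m ≤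
    ∑ e, ((ordinary ω x.1.1 x.1.2 x.2 e || hidden ω (!x.1.1) (!x.1.2) e).toNat : ℝ)

theorem prob_ordinaryCover_le {ε : ℝ} (hε : 0 ≤ ε) :
    prob (OrdinaryCover (m := m) (n := n) ε) ≤ 4 * n ^ 2 * Real.exp (-(ε ^ 2 * m / 2)) := by
  refine (prob_exists_le _ (Real.exp (-(ε ^ 2 * m / 2))) fun x => ?_).trans (le_of_eq ?_)
  · have h := prob_sum_sample_ge_le (m := m) (n := n) (Q := Bool)
      (sel := fun p => ((p, if p then x.1.2 else x.1.1), if p then x.2.2 else x.2.1))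
      (fun p q h => congrArg (fun y => y.1.1) h)
      (fun t _ c => ((member (sign false x.1.1 t) (c false) ||
        member (sign true x.1.2 t) (c true)).toNat : ℝ)) (R := 1) (μ := 179 / 240) (η := ε) one_pos
      (by norm_num) (by norm_num) (fun _ _ _ => by positivity) (fun _ _ _ => toNat_le_one _) ?_ hε
    · rw [show (2 : ℝ) * 1 ^ 2 = 2 by norm_num] at h
      exact h
    · have h2 := sum_member_or_member x.1.1 x.1.2
      simp only [expect_bool_arrow false, Fintype.expect_const]
      simp only [Fintype.expect_eq_sum_div_card, Fintype.card_fin, ← sum_div]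
      change (∑ t, ∑ y, ∑ z, (((member (sign false x.1.1 t) y ||
        member (sign true x.1.2 t) z).toNat : ℕ) : ℝ)) / _ / _ / _ ≤ _
      rw [← Nat.cast_inj (R := ℝ)] at h2
      push_cast at h2
      rw [h2]
      norm_num
  · simp only [Fintype.card_prod, Fintype.card_bool, Fintype.card_fin]
    push_cast
    ring

theorem prob_hiddenCover_le {ε : ℝ} (hε : 0 ≤ ε) :
    prob (HiddenCover (m := m) (n := n) ε) ≤ 4 * n * Real.exp (-(ε ^ 2 * m / 2)) := by
  refine (prob_exists_le _ (Real.exp (-(ε ^ 2 * m / 2))) fun x => ?_).trans (le_of_eq ?_)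
  · have h := prob_sum_sample_ge_le (m := m) (n := n) (Q := Unit) (sel := fun _ => x)
      (fun _ _ _ => rfl)
      (fun t u c => ((member (sign x.1.1 x.1.2 t) (c ()) ||
        hiddenMember (!x.1.1) (!x.1.2) t u).toNat : ℝ)) (R := 1) (μ := 179 / 240) (η := ε) one_pos
      (by norm_num) (by norm_num) (fun _ _ _ => by positivity) (fun _ _ _ => toNat_le_one _) ?_ hε
    · rw [show (2 : ℝ) * 1 ^ 2 = 2 by norm_num] at h
      exact h
    · have h2 := sum_member_or_hiddenMember x.1.1 x.1.2
      have h3 : ∀ t u, 𝔼 c : Unit → Fin 3, ((member (sign x.1.1 x.1.2 t) (c ()) ||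
          hiddenMember (!x.1.1) (!x.1.2) t u).toNat : ℝ) =
          𝔼 z : Fin 3, ((member (sign x.1.1 x.1.2 t) z ||
            hiddenMember (!x.1.1) (!x.1.2) t u).toNat : ℝ) := fun t u =>
        expect_eval (α := Fin 3) () (fun z => ((member (sign x.1.1 x.1.2 t) z ||
            hiddenMember (!x.1.1) (!x.1.2) t u).toNat : ℝ))
      simp only [h3]
      simp only [Fintype.expect_eq_sum_div_card, Fintype.card_fin, ← sum_div]
      rw [← Nat.cast_inj (R := ℝ)] at h2
      push_cast at h2
      rw [h2]
      norm_num
  · simp only [Fintype.card_prod, Fintype.card_bool, Fintype.card_fin]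
    push_cast
    ring

/-- The weights that an ordinary clause, or the hidden clause on average, gives to the items. -/
def weights (a : Bool) (ω : Sample m n) (p g : Bool) (j : Fin n) (e : Fin m) : ℝ :=
  (weight a p g (ω.1 e) (ω.2.2 (p, g) j e) : ℝ) / 18

/-- Some allocation would be good for both groups. -/
def BothGood (ε : ℝ) (ω : Sample m n) : Prop :=
  ∃ x : ((Bool × Bool) × (Bool × Bool)) × ((Fin n × Fin n) × (Fin n × Fin n)),
    (x.1.1.1 || x.1.1.2) = true ∧ (x.1.2.1 || x.1.2.2) = true ∧
    (2 * (179 / 240) + ε) * m ≤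
      ∑ e, max (weights x.1.1.1 ω false false x.2.1.1 e + weights x.1.2.1 ω false true x.2.2.1 e)
        (weights x.1.1.2 ω true false x.2.1.2 e + weights x.1.2.2 ω true true x.2.2.2 e)

theorem weight_le (a p g : Bool) (t : Fin 20) (z : Fin 3) : weight a p g t z ≤ 18 := by
  unfold weight
  split_ifs
  · exact (card_le_univ _).trans (by simp)
  · cases member (sign p g t) z <;> simp

theorem expect_four {α : Type*} [Fintype α] (H : α → α → α → α → ℝ) :
    𝔼 c : Bool × Bool → α, H (c (false, false)) (c (false, true)) (c (true, false)) (c (true, true))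
      = 𝔼 x, 𝔼 x', 𝔼 y, 𝔼 y', H x x' y y' := by
  have h1 : 𝔼 c : Bool × Bool → α,
      H (c (false, false)) (c (false, true)) (c (true, false)) (c (true, true)) =
      𝔼 c : Bool → Bool → α, H (c false false) (c false true) (c true false) (c true true) :=
    Fintype.expect_equiv (Equiv.curry Bool Bool α) _ _ fun _ => rfl
  rw [h1]
  simp only [expect_bool_arrow false]
  rfl

theorem prob_bothGood_le {ε : ℝ} (hε : 0 ≤ ε) :
    prob (BothGood (m := m) (n := n) ε) ≤ 16 * n ^ 4 * Real.exp (-(ε ^ 2 * m / 8)) := by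
  refine (prob_exists_le _ (Real.exp (-(ε ^ 2 * m / 8))) fun x => ?_).trans (le_of_eq ?_)
  · obtain ⟨⟨⟨a, b⟩, c, d⟩, ⟨j, k⟩, j', k'⟩ := x
    dsimp only
    by_cases hab : (a || b) = true
    swap
    · refine le_trans (le_of_eq ?_) (Real.exp_pos _).le
      simp [prob, hab]
    by_cases hcd : (c || d) = true
    swap
    · refine le_trans (le_of_eq ?_) (Real.exp_pos _).le
      simp [prob, hcd]
    have h := prob_sum_sample_ge_le (m := m) (n := n) (Q := Bool × Bool)
      (sel := fun q => (q, if q.1 then (if q.2 then k' else k) else (if q.2 then j' else j)))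
      (fun p q h => congrArg Prod.fst h)
      (fun t _ s => max (((weight a false false t (s (false, false)) : ℕ) : ℝ) / 18 +
          (weight c false true t (s (false, true)) : ℕ) / 18)
        (((weight b true false t (s (true, false)) : ℕ) : ℝ) / 18 +
          (weight d true true t (s (true, true)) : ℕ) / 18))
      (R := 2) (μ := 2 * (179 / 240)) (η := ε) two_pos
      (by norm_num) (by norm_num) (fun _ _ _ => le_max_of_le_left (by positivity))
      (fun t _ s => by
        have h : ∀ a p g z, ((weight a p g t z : ℕ) : ℝ) / 18 ≤ 1 := fun a p g z => by
          rw [div_le_one (by norm_num)]; exact_mod_cast weight_le a p g t z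
        refine max_le ?_ ?_ <;> refine (add_le_add (h _ _ _ _) (h _ _ _ _)).trans (by norm_num))
      ?_ hε
    · rw [show (2 : ℝ) * 2 ^ 2 = 8 by norm_num] at h
      exact (prob_mono fun ω hω => hω.2.2).trans h
    · have h2 := sum_max_weight_le a b c d hab hcd
      have h3 : ∀ t, 𝔼 s : Bool × Bool → Fin 3,
          max (((weight a false false t (s (false, false)) : ℕ) : ℝ) / 18 +
            (weight c false true t (s (false, true)) : ℕ) / 18)
          (((weight b true false t (s (true, false)) : ℕ) : ℝ) / 18 +
            (weight d true true t (s (true, true)) : ℕ) / 18) =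
          𝔼 x, 𝔼 x', 𝔼 y, 𝔼 y', ((max (weight a false false t x + weight c false true t x')
            (weight b true false t y + weight d true true t y') : ℕ) : ℝ) / 18 := by
        intro t
        refine (expect_four fun x x' y y' => max (((weight a false false t x : ℕ) : ℝ) / 18 +
            (weight c false true t x' : ℕ) / 18)
          (((weight b true false t y : ℕ) : ℝ) / 18 + (weight d true true t y' : ℕ) / 18)).trans ?_
        refine expect_congr rfl fun x _ => expect_congr rfl fun x' _ =>
          expect_congr rfl fun y _ => expect_congr rfl fun y' _ => ?_
        rw [← add_div, ← add_div, max_div_div_right (by norm_num)]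
        push_cast
        rfl
      simp only [h3, Fintype.expect_const]
      simp only [Fintype.expect_eq_sum_div_card, Fintype.card_fin, ← sum_div]
      rw [← Nat.cast_le (α := ℝ)] at h2
      push_cast at h2 ⊢
      linarith
  · simp only [Fintype.card_prod, Fintype.card_bool, Fintype.card_fin]
    push_cast
    ring

/-- Some hidden clause gets more of its items than it would on average. -/
def Deviates (η : ℝ) (ω : Sample m n) (S : Items m) : Prop :=
  ∃ x : Bool × Bool, η * m ≤
    gain x.1 S (fun e => ind (hidden ω x.1 x.2) e - (hiddenCount x.1 x.2 (ω.1 e) : ℝ) / 18)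

/-- As `S` ignores the hidden states, these stay independent after fixing the types and the ordinary
randomness, and each summand is centred. -/
theorem prob_deviates_le {η : ℝ} (hη : 0 ≤ η)
    (S : (Fin m → Fin 20) → (Bool × Bool → Fin n → Fin m → Fin 3) → Items m) :
    prob (fun ω : Sample m n => Deviates η ω (S ω.1 ω.2.2)) ≤
      4 * Real.exp (-(η ^ 2 * m / 2)) := by
  refine (prob_exists_le _ (Real.exp (-(η ^ 2 * m / 2))) fun x => ?_).trans (le_of_eq ?_)
  · rw [prob_prod]
    refine expect_le univ_nonempty fun t _ => ?_
    rw [prob_prod]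
    unfold prob
    rw [expect_comm]
    refine expect_le univ_nonempty fun s _ => ?_
    have h := prob_sum_ge_le (ι := Fin m) (L := Fin 18) (fun e u => if S t s e != x.1 then
        ((hiddenMember x.1 x.2 (t e) u).toNat : ℝ) - (hiddenCount x.1 x.2 (t e) : ℝ) / 18 else 0)
      (R := 1) one_pos (fun e u => ?_) (fun e => ?_) hη
    · rw [show (2 : ℝ) * 1 ^ 2 = 2 by norm_num, Fintype.card_fin] at h
      exact h
    · have h1 : (hiddenCount x.1 x.2 (t e) : ℝ) / 18 ≤ 1 := by
        rw [div_le_one (by norm_num)]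
        exact_mod_cast (card_le_univ _).trans (by simp)
      have h2 : (0 : ℝ) ≤ (hiddenCount x.1 x.2 (t e) : ℝ) / 18 := by positivity
      have h3 := toNat_le_one (hiddenMember x.1 x.2 (t e) u)
      have h4 : (0 : ℝ) ≤ ((hiddenMember x.1 x.2 (t e) u).toNat : ℝ) := by positivity
      split_ifs
      · rw [abs_le]; constructor <;> linarith
      · simp
    · split_ifs
      · rw [expect_sub_distrib, Fintype.expect_const, Fintype.expect_eq_sum_div_card, hiddenCount,
          card_filter]
        push_cast
        refine le_of_eq (sub_eq_zero.2 ?_)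
        congr 1
        refine sum_congr rfl fun u _ => ?_
        cases hiddenMember x.1 x.2 (t e) u <;> simp
      · simp
  · simp only [Fintype.card_prod, Fintype.card_bool]
    norm_num

end Tests

/-! ### The two scenarios and the hybrid -/

section TwoScenarios

variable {m n : ℕ}

/-- The flags of the scenario in which the special clauses are those of group `θ`. -/
def groupFlags (θ : Bool) : Bool → Bool → Bool := fun _ g => g == θ

/-- In scenario `θ`, the allocation `S` is good. -/
def Success (ε : ℝ) (θ : Bool) (i : Fin n) (ω : Sample m n) (S : Items m) : Prop :=
  ∃ x y : Bool × Fin n, (179 / 240 + ε) * m ≤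
    gain false S (ind (clauses (groupFlags θ) i ω false x.1 x.2)) +
      gain true S (ind (clauses (groupFlags θ) i ω true y.1 y.2))

/-- The hidden clause or an ordinary one. -/
def pick (a : Bool) (ω : Sample m n) (p g : Bool) (j : Fin n) : Items m :=
  if a then hidden ω p g else ordinary ω p g j

/-- The allocation `S` is good by means of clauses of group `θ`, not both of them ordinary. -/
def GoodFor (ε : ℝ) (θ : Bool) (ω : Sample m n) (S : Items m) : Prop :=
  ∃ a b : Bool, ∃ j k : Fin n, (a || b) = true ∧ (179 / 240 + ε) * m ≤
    gain false S (ind (pick a ω false θ j)) + gain true S (ind (pick b ω true θ k))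

theorem clauses_groupFlags (θ : Bool) (i : Fin n) (ω : Sample m n) (p g : Bool) (j : Fin n) :
    clauses (groupFlags θ) i ω p g j = hidden ω p θ ∨
      clauses (groupFlags θ) i ω p g j = ordinary ω p g j := by
  unfold clauses groupFlags
  by_cases hg : g = θ
  · subst hg
    by_cases hj : j = i
    · subst hj; left; simp
    · right; simp [Function.update_of_ne hj]
  · right
    rw [if_neg (by simpa using hg)]

/-- Disjoint bundles earn at most the union of the two clauses. So two ordinary clauses, or a hidden
one and one of the other group, fall under the cover events. -/
theorem Success.cases {ε : ℝ} {θ : Bool} {i : Fin n} {ω : Sample m n} {S : Items m}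
    (h : Success ε θ i ω S) : (OrdinaryCover ε ω ∨ HiddenCover ε ω) ∨ GoodFor ε θ ω S := by
  obtain ⟨⟨g, j⟩, ⟨g', k⟩, h⟩ := h
  have hne : ∀ {a b : Bool}, a ≠ b → b = !a := by decide
  rcases clauses_groupFlags θ i ω false g j with hA | hA <;>
    rcases clauses_groupFlags θ i ω true g' k with hB | hB <;> rw [hA, hB] at h
  · exact Or.inr ⟨true, true, i, i, rfl, h⟩
  · by_cases hg : g' = θ
    · subst hg
      exact Or.inr ⟨true, false, i, k, rfl, h⟩
    · refine Or.inl (Or.inr ⟨((true, g'), k), h.trans ((gain_ind_add_gain_ind_le _ _ _).trans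
        (le_of_eq (sum_congr rfl fun e _ => ?_)))⟩)
      rw [hne hg, Bool.or_comm]
      rfl
  · by_cases hg : g = θ
    · subst hg
      exact Or.inr ⟨false, true, j, i, rfl, h⟩
    · refine Or.inl (Or.inr ⟨((false, g), j), h.trans ((gain_ind_add_gain_ind_le _ _ _).trans
        (le_of_eq (sum_congr rfl fun e _ => ?_)))⟩)
      rw [hne hg]
      rfl
  · exact Or.inl (Or.inl ⟨((g, g'), (j, k)), h.trans (gain_ind_add_gain_ind_le _ _ _)⟩)

theorem gain_pick_le {η : ℝ} (hη : 0 ≤ η) {ω : Sample m n} {S : Items m}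
    (h : ¬ Deviates η ω S) (a p g : Bool) (j : Fin n) :
    gain p S (ind (pick a ω p g j)) ≤ gain p S (weights a ω p g j) + η * m := by
  cases a with
  | false =>
    have : weights false ω p g j = ind (pick false ω p g j) := by
      funext e
      simp only [weights, weight, pick, ind, Bool.false_eq_true, if_false]
      push_cast
      rw [mul_div_cancel_left₀ _ (by norm_num)]
      rfl
    rw [this]
    have : 0 ≤ η * m := by positivity
    linarith
  | true =>
    have h1 := not_le.1 fun hle => h ⟨(p, g), hle⟩
    have h2 : gain p S (ind (pick true ω p g j)) =
        gain p S (fun e => ind (hidden ω p g) e - (hiddenCount p g (ω.1 e) : ℝ) / 18) +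
          gain p S (weights true ω p g j) := by
      rw [← gain_add]
      congr 1
      funext e
      simp [weights, weight, pick]
    rw [h2]
    dsimp only at h1
    linarith

/-- Adding both hypotheses gives a margin `2 * ε`; passing to mean weights for four clauses costs at
most `4 * (ε / 4)`. -/
theorem BothGood.of_goodFor {ε : ℝ} (hε : 0 ≤ ε) {ω : Sample m n} {S : Items m}
    (h0 : GoodFor ε false ω S) (h1 : GoodFor ε true ω S) (hd : ¬ Deviates (ε / 4) ω S) :
    BothGood ε ω := by
  obtain ⟨a, b, j, k, hab, h0⟩ := h0
  obtain ⟨c, d, j', k', hcd, h1⟩ := h1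
  refine ⟨(((a, b), (c, d)), ((j, k), (j', k'))), hab, hcd, ?_⟩
  have hη : 0 ≤ ε / 4 := by positivity
  have e1 := gain_pick_le hη hd a false false j
  have e2 := gain_pick_le hη hd b true false k
  have e3 := gain_pick_le hη hd c false true j'
  have e4 := gain_pick_le hη hd d true true k'
  refine le_trans ?_ (gain_add_gain_le S
    (fun e => weights a ω false false j e + weights c ω false true j' e)
    (fun e => weights b ω true false k e + weights d ω true true k' e))
  rw [gain_add, gain_add]
  linarith

section Average

variable {M : Type*} (msg : Bool → (Bool → Fin n → Items m) → M) (out : M → M → Items m)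

/-- The probability of an event that depends on the sample and the outcome, for a random `i`. -/
def runProb (κ : Bool → Bool → Bool) (P : Sample m n → Items m → Prop) : ℝ :=
  𝔼 i, prob fun ω => P ω (run msg out κ i ω)

theorem runProb_goodFor_add_le {ε : ℝ} (hε : 0 ≤ ε) (hn : 0 < n) :
    runProb msg out (fun _ _ => true) (GoodFor ε false) +
      runProb msg out (fun _ _ => true) (GoodFor ε true) ≤
      1 + prob (BothGood (m := m) (n := n) ε) +
        runProb msg out (fun _ _ => true) (Deviates (ε / 4)) := by
  have : Nonempty (Fin n) := ⟨⟨0, hn⟩⟩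
  have h1 : (1 : ℝ) + prob (BothGood (m := m) (n := n) ε) =
      𝔼 _i : Fin n, (1 + prob (BothGood (m := m) (n := n) ε)) := by
    rw [Fintype.expect_const]
  rw [h1, runProb, runProb, runProb, ← expect_add_distrib, ← expect_add_distrib]
  refine expect_mono fun i => ?_
  rw [← Fintype.expect_one (ι := Sample m n), prob, prob, prob, prob, ← expect_add_distrib,
    ← expect_add_distrib, ← expect_add_distrib]
  refine expect_mono fun ω => ?_
  set S := run msg out (fun _ _ => true) i ω
  by_cases h0 : GoodFor ε false ω S <;> by_cases h1 : GoodFor ε true ω S <;>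
    by_cases hd : Deviates (ε / 4) ω S <;> by_cases hb : BothGood ε ω <;>
    simp only [h0, h1, hd, hb, if_true, if_false] <;> try norm_num
  exact hb (BothGood.of_goodFor hε h0 h1 hd)

variable [Fintype M] [DecidableEq M] [Nonempty M]

/-- The flags with the one of bidder `p` and group `g` removed. -/
def drop (κ : Bool → Bool → Bool) (p g : Bool) : Bool → Bool → Bool :=
  fun p' g' => if (p', g') = (p, g) then false else κ p' g'

theorem runProb_le_drop (κ : Bool → Bool → Bool) (p g : Bool) (hκ : κ p g = true)
    (P : Sample m n → Items m → Prop) (hP : ∀ ω s a, P (resample ω (p, g) s) a ↔ P ω a)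
    (hn : 0 < n) {lam : ℝ} (hlam : 0 < lam) :
    runProb msg out κ P ≤ runProb msg out (drop κ p g) P +
      (Real.log (Fintype.card M) / lam / n + lam / 2) := by
  classical
  have hn' : (0 : ℝ) < n := by exact_mod_cast hn
  have h := sum_expect_run_sub_le msg out κ (drop κ p g) p g hκ (by simp [drop])
    (fun p' g' hne => by simp only [drop, if_neg hne]) (fun ω a => if P ω a then 1 else 0)
    (fun _ _ => by split_ifs <;> norm_num) (fun _ _ => by split_ifs <;> norm_num)
    (fun ω s a => if_congr (hP ω s a) rfl rfl) hlam
  have h2 : runProb msg out κ P - runProb msg out (drop κ p g) P =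
      (∑ i, ((𝔼 ω : Sample m n, if P ω (run msg out κ i ω) then (1 : ℝ) else 0) -
      𝔼 ω : Sample m n, if P ω (run msg out (drop κ p g) i ω) then (1 : ℝ) else 0)) / n := by
    rw [runProb, runProb, ← expect_sub_distrib, Fintype.expect_eq_sum_div_card, Fintype.card_fin]
    simp only [prob]
  have h3 := (div_le_div_iff_of_pos_right hn').2 h
  rw [← h2, add_div] at h3
  have h4 : n * lam / 2 / n = lam / 2 := by field_simp
  linarith

/-- The reverse comparison, obtained from the complementary event. -/
theorem drop_runProb_le (κ : Bool → Bool → Bool) (p g : Bool) (hκ : κ p g = true)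
    (P : Sample m n → Items m → Prop) (hP : ∀ ω s a, P (resample ω (p, g) s) a ↔ P ω a)
    (hn : 0 < n) {lam : ℝ} (hlam : 0 < lam) :
    runProb msg out (drop κ p g) P ≤ runProb msg out κ P +
      (Real.log (Fintype.card M) / lam / n + lam / 2) := by
  have : Nonempty (Fin n) := ⟨⟨0, hn⟩⟩
  have h := runProb_le_drop msg out κ p g hκ (fun ω a => ¬ P ω a)
    (fun ω s a => not_congr (hP ω s a)) hn hlam
  have h2 : ∀ κ, runProb msg out κ (fun ω a => ¬ P ω a) = 1 - runProb msg out κ P := fun κ => by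
    rw [runProb, runProb, ← Fintype.expect_one (ι := Fin n), ← expect_sub_distrib]
    exact expect_congr rfl fun i _ => expect_one_sub_prob _
  rw [h2, h2] at h
  linarith

theorem pick_resample (a : Bool) (ω : Sample m n) (p g : Bool) (j : Fin n) {x : Bool × Bool}
    (hx : x ≠ (p, g)) (s : Fin n → Fin m → Fin 3) :
    pick a (resample ω x s) p g j = pick a ω p g j := by
  have : ordinary (resample ω x s) p g = ordinary ω p g := by
    simp [ordinary, resample, Function.update_of_ne hx.symm]
  rw [pick, pick, this]
  rfl

theorem goodFor_resample (ε : ℝ) (θ : Bool) (ω : Sample m n) (p : Bool)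
    (s : Fin n → Fin m → Fin 3) (S : Items m) :
    GoodFor ε θ (resample ω (p, !θ) s) S ↔ GoodFor ε θ ω S := by
  unfold GoodFor
  have h : ∀ a p' j, pick a (resample ω (p, !θ) s) p' θ j = pick a ω p' θ j :=
    fun a p' j => pick_resample a ω p' θ j (by simp) s
  simp only [h]

theorem deviates_resample (η : ℝ) (ω : Sample m n) (x : Bool × Bool)
    (s : Fin n → Fin m → Fin 3) (S : Items m) :
    Deviates η (resample ω x s) S ↔ Deviates η ω S := Iff.rfl

/-- Scenario and hybrid differ in the other group's flags of the two bidders: two swaps, whose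
ordinary blocks the event ignores. -/
theorem runProb_goodFor_le (ε : ℝ) (θ : Bool) (hn : 0 < n) {lam : ℝ} (hlam : 0 < lam) :
    runProb msg out (groupFlags θ) (GoodFor ε θ) ≤
      runProb msg out (fun _ _ => true) (GoodFor ε θ) +
        2 * (Real.log (Fintype.card M) / lam / n + lam / 2) := by
  have h1 := drop_runProb_le msg out (fun _ _ => true) false (!θ) rfl (GoodFor ε θ)
    (fun ω s a => goodFor_resample ε θ ω false s a) hn hlam
  have h2 := drop_runProb_le msg out (drop (fun _ _ => true) false (!θ)) true (!θ) rfl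
    (GoodFor ε θ) (fun ω s a => goodFor_resample ε θ ω true s a) hn hlam
  have h3 : drop (drop (fun _ _ => true) false (!θ)) true (!θ) = groupFlags θ := by
    funext p g
    cases p <;> cases g <;> cases θ <;> rfl
  rw [h3] at h2
  linarith

/-- Four swaps remove every hidden clause from the messages; the event ignores all ordinary clauses.
-/
theorem runProb_deviates_le {η : ℝ} (hη : 0 ≤ η) (hn : 0 < n) {lam : ℝ} (hlam : 0 < lam) :
    runProb msg out (fun _ _ => true) (Deviates η) ≤ 4 * Real.exp (-(η ^ 2 * m / 2)) +
        4 * (Real.log (Fintype.card M) / lam / n + lam / 2) := by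
  have : Nonempty (Fin n) := ⟨⟨0, hn⟩⟩
  have hP := fun (p g : Bool) (ω : Sample m n) (s : Fin n → Fin m → Fin 3) (a : Items m) =>
    deviates_resample η ω (p, g) s a
  set κ₁ := drop (fun _ _ => true) false false with hκ₁
  set κ₂ := drop κ₁ false true with hκ₂
  set κ₃ := drop κ₂ true false with hκ₃
  have h1 := runProb_le_drop msg out (fun _ _ => true) false false rfl _ (hP _ _) hn hlam
  have h2 := runProb_le_drop msg out κ₁ false true rfl _ (hP _ _) hn hlam
  have h3 := runProb_le_drop msg out κ₂ true false rfl _ (hP _ _) hn hlam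
  have h4 := runProb_le_drop msg out κ₃ true true rfl _ (hP _ _) hn hlam
  have h5 : drop κ₃ true true = fun _ _ => false := by
    funext p g
    cases p <;> cases g <;> rfl
  have h6 : runProb msg out (fun _ _ => false) (Deviates η) ≤
      4 * Real.exp (-(η ^ 2 * m / 2)) := by
    refine expect_le univ_nonempty fun i _ => ?_
    -- With no flag set, the run ignores the hidden states, so any constant may stand in for them.
    exact prob_deviates_le hη fun t s => run msg out (fun _ _ => false) i (t, fun _ => 0, s)
  rw [h5] at h4
  linarith

/-- With short simultaneous messages, the probabilities of success in the two scenarios sum to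
hardly more than one. -/
theorem sum_success_le {ε : ℝ} (hε : 0 ≤ ε) (hn : 0 < n) {lam : ℝ} (hlam : 0 < lam) :
    ∑ θ, 𝔼 i, prob (fun ω : Sample m n => Success ε θ i ω (run msg out (groupFlags θ) i ω)) ≤
      1 + 16 * n ^ 4 * Real.exp (-(ε ^ 2 * m / 8)) + 4 * Real.exp (-(ε ^ 2 * m / 32)) +
        16 * n ^ 2 * Real.exp (-(ε ^ 2 * m / 2)) +
        8 * (Real.log (Fintype.card M) / lam / n + lam / 2) := by
  have : Nonempty (Fin n) := ⟨⟨0, hn⟩⟩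
  have h1 : ∀ θ, 𝔼 i, prob (fun ω : Sample m n =>
      Success ε θ i ω (run msg out (groupFlags θ) i ω)) ≤
      8 * n ^ 2 * Real.exp (-(ε ^ 2 * m / 2)) +
        runProb msg out (groupFlags θ) (GoodFor ε θ) := by
    intro θ
    rw [← Fintype.expect_const (ι := Fin n) (8 * n ^ 2 * Real.exp (-(ε ^ 2 * m / 2))), runProb,
      ← expect_add_distrib]
    refine expect_mono fun i => (prob_mono fun ω h => h.cases).trans
      ((prob_or_le _ _).trans (add_le_add ((prob_or_le _ _).trans ?_) le_rfl))
    refine (add_le_add (prob_ordinaryCover_le hε) (prob_hiddenCover_le hε)).trans ?_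
    rw [← add_mul]
    refine mul_le_mul_of_nonneg_right ?_ (Real.exp_pos _).le
    have : (1 : ℝ) ≤ n := by exact_mod_cast hn
    nlinarith
  have h2 := fun θ => runProb_goodFor_le msg out ε θ hn hlam
  have h3 := runProb_deviates_le msg out (η := ε / 4) (by positivity) hn hlam
  rw [show (ε / 4) ^ 2 * m / 2 = ε ^ 2 * m / 32 by ring] at h3
  have h4 := runProb_goodFor_add_le msg out hε hn
  have h5 := prob_bothGood_le (m := m) (n := n) hε
  rw [Fintype.sum_bool]
  have := h1 false
  have := h1 true
  have := h2 false
  have := h2 true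
  linarith

end Average

end TwoScenarios

/-! ### From clauses to valuations and welfare -/

section Valuations

variable {m n : ℕ}

/-- The set with a given indicator function. -/
def itemSet (c : Items m) : Finset (Fin m) := univ.filter fun e => c e = true

/-- The indicator function of a set. -/
def items (S : Finset (Fin m)) : Items m := fun e => decide (e ∈ S)

theorem card_inter_itemSet (S : Finset (Fin m)) (c : Items m) :
    ((S ∩ itemSet c).card : ℝ) = ∑ e, if e ∈ S then ind c e else 0 := by
  have h : S ∩ itemSet c = univ.filter fun e => e ∈ S ∧ c e = true := by
    ext e; simp [itemSet]
  rw [h, card_filter]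
  push_cast
  refine sum_congr rfl fun e _ => ?_
  by_cases hS : e ∈ S <;> cases hc : c e <;> simp [hS, hc, ind]

theorem card_inter_le_gain_false (S : Finset (Fin m)) (c : Items m) :
    ((S ∩ itemSet c).card : ℝ) ≤ gain false (items S) (ind c) := by
  rw [card_inter_itemSet, gain]
  refine sum_le_sum fun e _ => ?_
  by_cases hS : e ∈ S <;> simp [hS, items]

theorem card_inter_le_gain_true {S T : Finset (Fin m)} (h : Disjoint S T) (c : Items m) :
    ((T ∩ itemSet c).card : ℝ) ≤ gain true (items S) (ind c) := by
  rw [card_inter_itemSet, gain]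
  refine sum_le_sum fun e _ => ?_
  by_cases hT : e ∈ T
  · have hS : e ∉ S := fun hS => disjoint_left.1 h hS hT
    simp [hS, hT, items]
  · rw [if_neg hT]
    split_ifs
    · exact Nat.cast_nonneg _
    · exact le_rfl

variable [NeZero n]

/-- The clauses as sets of items. -/
def clauseSets (C : Bool → Fin n → Items m) : Finset (Finset (Fin m)) :=
  univ.image fun x : Bool × Fin n => itemSet (C x.1 x.2)

theorem clauseSets_nonempty (C : Bool → Fin n → Items m) : (clauseSets C).Nonempty :=
  univ_nonempty.image _

/-- The Binary-XOS valuation with given clauses. -/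
def valuation (C : Bool → Fin n → Items m) : BXOS m :=
  ⟨fun S => (((clauseSets C).sup' (clauseSets_nonempty C) fun c => (S ∩ c).card : ℕ) : ℝ),
    clauseSets C, clauseSets_nonempty C, fun _ => rfl⟩

theorem card_inter_le_valuation (C : Bool → Fin n → Items m) (g : Bool) (j : Fin n)
    (S : Finset (Fin m)) : ((S ∩ itemSet (C g j)).card : ℝ) ≤ (valuation C).1 S :=
  Nat.cast_le.2 (le_sup' (fun c => (S ∩ c).card)
    (mem_image_of_mem (fun x : Bool × Fin n => itemSet (C x.1 x.2)) (mem_univ (g, j))))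

theorem exists_valuation_eq (C : Bool → Fin n → Items m) (S : Finset (Fin m)) :
    ∃ x : Bool × Fin n, (valuation C).1 S = ((S ∩ itemSet (C x.1 x.2)).card : ℝ) := by
  obtain ⟨c, hc, h⟩ := exists_mem_eq_sup' (clauseSets_nonempty C) fun c => (S ∩ c).card
  obtain ⟨x, -, rfl⟩ := mem_image.1 hc
  exact ⟨x, congrArg Nat.cast h⟩

/-- The valuation of bidder `p` in scenario `θ`. -/
def input (θ : Bool) (i : Fin n) (ω : Sample m n) (p : Bool) : BXOS m :=
  valuation (clauses (groupFlags θ) i ω p)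

/-- Each bidder gets their own hidden clause; the two are complementary. -/
theorem le_opt_input (θ : Bool) (i : Fin n) (ω : Sample m n) :
    (m : ℝ) ≤ opt (input θ i ω false).1 (input θ i ω true).1 := by
  set A := itemSet (hidden ω false θ)
  set B := itemSet (hidden ω true θ)
  have hB : B = Aᶜ := by
    ext e
    have h : hidden ω true θ e = !hidden ω false θ e := hiddenMember_not false θ _ _
    simp only [A, B, itemSet, mem_filter, mem_univ, true_and, mem_compl, h]
    simp
  have hmem : (A, B) ∈ univ.filter fun S : Finset (Fin m) × Finset (Fin m) => Disjoint S.1 S.2 := by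
    simp [hB, disjoint_compl_right]
  have hcl : ∀ p, clauses (groupFlags θ) i ω p θ i = hidden ω p θ := fun p => by
    simp [clauses, groupFlags]
  have h1 := card_inter_le_valuation (clauses (groupFlags θ) i ω false) θ i A
  have h2 := card_inter_le_valuation (clauses (groupFlags θ) i ω true) θ i B
  rw [hcl, inter_self] at h1 h2
  have h3 : (A.card : ℝ) + B.card = m := by
    rw [hB, ← Nat.cast_add, card_add_card_compl, Fintype.card_fin]
  have h4 := le_sup' (fun S : Finset (Fin m) × Finset (Fin m) =>
    (input θ i ω false).1 S.1 + (input θ i ω true).1 S.2) hmem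
  exact h3.symm.le.trans ((add_le_add h1 h2).trans h4)

theorem success_of_welfare {ε : ℝ} (hε : 0 ≤ ε) {θ : Bool} {i : Fin n} {ω : Sample m n}
    {O : Finset (Fin m) × Finset (Fin m)} (hO : Disjoint O.1 O.2)
    (h : (3 / 4 - 1 / 240 + ε) * opt (input θ i ω false).1 (input θ i ω true).1 ≤
      (input θ i ω false).1 O.1 + (input θ i ω true).1 O.2) :
    Success ε θ i ω (items O.1) := by
  obtain ⟨x, hx⟩ := exists_valuation_eq (clauses (groupFlags θ) i ω false) O.1
  obtain ⟨y, hy⟩ := exists_valuation_eq (clauses (groupFlags θ) i ω true) O.2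
  refine ⟨x, y, ?_⟩
  calc (179 / 240 + ε) * (m : ℝ)
      ≤ (179 / 240 + ε) * opt (input θ i ω false).1 (input θ i ω true).1 :=
        mul_le_mul_of_nonneg_left (le_opt_input θ i ω) (by positivity)
    _ = (3 / 4 - 1 / 240 + ε) * opt (input θ i ω false).1 (input θ i ω true).1 := by norm_num
    _ ≤ _ := h
    _ ≤ _ := add_le_add (hx.le.trans (card_inter_le_gain_false _ _))
        (hy.le.trans (card_inter_le_gain_true hO _))

end Valuations

/-! ### Short bit strings as a finite alphabet -/

section Encoding

/-- Encodes the bit strings of length at most `k` by the elements of a finite type. -/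
def encode (k : ℕ) (l : Message) : Fin k → Option Bool := fun i => l[i.1]?

/-- A left inverse of `encode` on short bit strings. -/
def decode (k : ℕ) : (Fin k → Option Bool) → Message :=
  Function.invFunOn (encode k) {l | l.length ≤ k}

theorem decode_encode {k : ℕ} {l : Message} (hl : l.length ≤ k) : decode k (encode k l) = l := by
  refine Set.InjOn.leftInvOn_invFunOn (f := encode k) (fun l₁ h₁ l₂ h₂ h => ?_) hl
  refine List.ext_getElem? fun i => ?_
  by_cases hi : i < k
  · exact congrFun h ⟨i, hi⟩
  · rw [List.getElem?_eq_none (le_trans h₁ (not_lt.1 hi)),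
      List.getElem?_eq_none (le_trans h₂ (not_lt.1 hi))]

theorem log_card_encoding_le (k : ℕ) :
    Real.log (Fintype.card (Fin k → Option Bool)) ≤ 2 * k := by
  have h3 : Real.log 3 ≤ 2 := (Real.log_le_sub_one_of_pos (by norm_num)).trans (by norm_num)
  have hk : (0 : ℝ) ≤ k := Nat.cast_nonneg k
  simp only [Fintype.card_fun, Fintype.card_option, Fintype.card_bool, Fintype.card_fin]
  push_cast
  rw [Real.log_pow]
  nlinarith

end Encoding

/-! ### Simultaneous protocols: execution, measurability, lower bound -/

section Simultaneous

variable {m : ℕ} {V : Set (Valuation m)} {P : Protocol m V}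

theorem Protocol.IsSimultaneous.finalHistory (hP : P.IsSimultaneous) (vA vB : V) :
    P.finalHistory vA vB = some ⟨[P.alice vA []], [P.bob vB []], [], []⟩ := by
  classical
  have h := hP vA vB
  unfold Protocol.rounds at h
  by_cases hT : P.Terminates vA vB
  swap
  · rw [dif_neg hT] at h
    exact absurd h (by simp)
  rw [dif_pos hT] at h
  have h0 : Nat.find hT = 0 := by
    have : Nat.find hT + 1 = 1 := by exact_mod_cast h
    omega
  rw [Protocol.finalHistory, dif_pos hT]
  have h1 : P.historyAfter vA vB (Nat.find hT) = some ⟨[], [], [], []⟩ := by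
    rw [h0]; rfl
  exact congrArg (Option.map (P.bidderStep vA vB)) h1

theorem Protocol.IsSimultaneous.achievesOn_iff (hP : P.IsSimultaneous) (α : ℝ) (vA vB : V) :
    P.AchievesOn α vA vB ↔ α * opt vA.1 vB.1 ≤
      vA.1 (P.alloc [P.alice vA []] [P.bob vB []]).1 +
        vB.1 (P.alloc [P.alice vA []] [P.bob vB []]).2 := by
  simp [Protocol.AchievesOn, Protocol.allocation, hP.finalHistory]

theorem Protocol.IsSimultaneous.length_le (hP : P.IsSimultaneous) {k : ℕ}
    (hk : P.cc ≤ (k : ℕ∞)) (vA vB : V) :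
    (P.alice vA []).length ≤ k ∧ (P.bob vB []).length ≤ k := by
  have h1 : P.ccOn vA vB ≤ (k : ℕ∞) :=
    (le_iSup₂ (f := fun (vA : V) (vB : V) => P.ccOn vA vB) vA vB).trans hk
  rw [Protocol.ccOn, hP.finalHistory] at h1
  have h2 : (P.alice vA []).length + (P.bob vB []).length ≤ k := by
    have := Nat.cast_le.1 h1
    simpa [History.bits] using this
  omega

theorem Protocol.measurableSet_alice (v : V) (s : Transcript) (a : Message) :
    MeasurableSet {P : Protocol m V | P.alice v s = a} := by
  have h : MeasurableSpace.comap (fun P : Protocol m V => P.alice v s) ⊤ ≤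
      (inferInstance : MeasurableSpace (Protocol m V)) :=
    le_trans (le_iSup₂ (f := fun (v : V) (s : Transcript) =>
      MeasurableSpace.comap (fun P : Protocol m V => P.alice v s) ⊤) v s)
      (le_sup_left.trans (le_sup_left.trans (le_sup_left.trans le_sup_left)))
  exact h _ ⟨{a}, trivial, rfl⟩

theorem Protocol.measurableSet_bob (v : V) (s : Transcript) (b : Message) :
    MeasurableSet {P : Protocol m V | P.bob v s = b} := by
  have h : MeasurableSpace.comap (fun P : Protocol m V => P.bob v s) ⊤ ≤
      (inferInstance : MeasurableSpace (Protocol m V)) :=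
    le_trans (le_iSup₂ (f := fun (v : V) (s : Transcript) =>
      MeasurableSpace.comap (fun P : Protocol m V => P.bob v s) ⊤) v s)
      (le_sup_right.trans (le_sup_left.trans (le_sup_left.trans le_sup_left)))
  exact h _ ⟨{b}, trivial, rfl⟩

theorem Protocol.measurableSet_alloc (s t : Transcript)
    (X : Set (Finset (Fin m) × Finset (Fin m))) :
    MeasurableSet {P : Protocol m V | P.alloc s t ∈ X} := by
  have h : MeasurableSpace.comap (fun P : Protocol m V => P.alloc s t) ⊤ ≤
      (inferInstance : MeasurableSpace (Protocol m V)) :=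
    le_trans (le_iSup₂ (f := fun (s : Transcript) (t : Transcript) =>
      MeasurableSpace.comap (fun P : Protocol m V => P.alloc s t) ⊤) s t)
      (le_sup_right.trans le_sup_left)
  exact h _ ⟨X, trivial, rfl⟩

/-- Splitting by the two messages gives a countable union of events, each about single values of the
protocol's functions. -/
theorem Protocol.measurableSet_alloc_first (vA vB : V)
    (X : Set (Finset (Fin m) × Finset (Fin m))) :
    MeasurableSet {P : Protocol m V | P.alloc [P.alice vA []] [P.bob vB []] ∈ X} := by
  have h : {P : Protocol m V | P.alloc [P.alice vA []] [P.bob vB []] ∈ X} =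
      ⋃ (a : Message) (b : Message), {P : Protocol m V | P.alice vA [] = a} ∩
        {P | P.bob vB [] = b} ∩ {P | P.alloc [a] [b] ∈ X} := by
    ext P
    simp
  rw [h]
  exact MeasurableSet.iUnion fun a => MeasurableSet.iUnion fun b =>
    ((measurableSet_alice vA [] a).inter (measurableSet_bob vB [] b)).inter
      (measurableSet_alloc [a] [b] X)

/-- No simultaneous protocol with short messages is good in both scenarios. -/
theorem sum_achievesOn_le {n k : ℕ} [NeZero n] {P : Protocol m (BXOS m)} (hP : P.IsSimultaneous)
    (hk : P.cc ≤ (k : ℕ∞)) {ε : ℝ} (hε : 0 ≤ ε) {lam : ℝ} (hlam : 0 < lam) :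
    ∑ θ, 𝔼 i : Fin n, prob (fun ω : Sample m n =>
      P.AchievesOn (3 / 4 - 1 / 240 + ε) (input θ i ω false) (input θ i ω true)) ≤
      1 + 16 * n ^ 4 * Real.exp (-(ε ^ 2 * m / 8)) + 4 * Real.exp (-(ε ^ 2 * m / 32)) +
        16 * n ^ 2 * Real.exp (-(ε ^ 2 * m / 2)) + 8 * (2 * k / lam / n + lam / 2) := by
  have hn : 0 < n := Nat.pos_of_neZero n
  set msg : Bool → (Bool → Fin n → Items m) → (Fin k → Option Bool) := fun p C =>
    encode k (if p then P.bob (valuation C) [] else P.alice (valuation C) []) with hmsg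
  set out : (Fin k → Option Bool) → (Fin k → Option Bool) → Items m := fun μ ν =>
    items (P.alloc [decode k μ] [decode k ν]).1 with hout
  have hrun : ∀ θ i (ω : Sample m n), run msg out (groupFlags θ) i ω =
      items (P.alloc [P.alice (input θ i ω false) []] [P.bob (input θ i ω true) []]).1 := by
    intro θ i ω
    have h := hP.length_le hk (input θ i ω false) (input θ i ω true)
    simp only [run, hmsg, hout, Bool.false_eq_true, if_false, if_true]
    change items (P.alloc [decode k (encode k (P.alice (input θ i ω false) []))]
      [decode k (encode k (P.bob (input θ i ω true) []))]).1 = _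
    rw [decode_encode h.1, decode_encode h.2]
  have h := sum_success_le (m := m) msg out hε hn hlam
  refine le_trans (sum_le_sum fun θ _ => expect_mono fun i => prob_mono fun ω hω => ?_)
    (h.trans ?_)
  · rw [hP.achievesOn_iff] at hω
    rw [hrun]
    exact success_of_welfare hε (P.alloc_disjoint _ _) hω
  · have := log_card_encoding_le k
    gcongr

end Simultaneous

/-! ### Averaging over protocols and the choice of parameters -/

section Randomized

/-- The easy direction of Yao's principle: exchange the averages over inputs and over protocols. -/
theorem expect_measureReal_le {Ω J : Type*} [MeasurableSpace Ω] (μ : Measure Ω)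
    [IsProbabilityMeasure μ] [Fintype J] (E : J → Set Ω) (hE : ∀ j, MeasurableSet (E j)) (b : ℝ)
    (h : ∀ᵐ x ∂μ, prob (fun j => x ∈ E j) ≤ b) : 𝔼 j, μ.real (E j) ≤ b := by
  classical
  have h1 : ∀ j, μ.real (E j) = ∫ x, (E j).indicator (fun _ => (1 : ℝ)) x ∂μ := fun j => by
    rw [integral_indicator_const _ (hE j)]; simp
  have hint : ∀ j, Integrable ((E j).indicator fun _ => (1 : ℝ)) μ := fun j =>
    (integrable_const 1).indicator (hE j)
  have h2 : 𝔼 j, μ.real (E j) = ∫ x, prob (fun j => x ∈ E j) ∂μ := by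
    simp only [prob, Fintype.expect_eq_sum_div_card]
    rw [integral_div]
    congr 1
    simp only [h1]
    rw [← integral_finsetSum _ fun j _ => hint j]
    refine integral_congr_ae (Filter.Eventually.of_forall fun x => sum_congr rfl fun j _ => ?_)
    simp [Set.indicator]
  rw [h2]
  calc ∫ x, prob (fun j => x ∈ E j) ∂μ ≤ ∫ _x, b ∂μ := by
        refine integral_mono_ae ?_ (integrable_const b) h
        simp only [prob, Fintype.expect_eq_sum_div_card]
        refine (integrable_finsetSum _ fun j _ => ?_).div_const _
        refine (hint j).congr (Filter.Eventually.of_forall fun x => ?_)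
        simp [Set.indicator]
    _ = b := by simp

theorem two_mul_prob_le {m n k : ℕ} [NeZero n] (R : RandomizedProtocol m (BXOS m))
    (hsim : R.IsSimultaneous) (hk : R.cc ≤ (k : ℕ∞)) {ε p : ℝ} (hε : 0 ≤ ε)
    (happ : R.IsApproxWithProb (3 / 4 - 1 / 240 + ε) p) {lam : ℝ} (hlam : 0 < lam) :
    2 * p ≤ 1 + 16 * n ^ 4 * Real.exp (-(ε ^ 2 * m / 8)) + 4 * Real.exp (-(ε ^ 2 * m / 32)) +
        16 * n ^ 2 * Real.exp (-(ε ^ 2 * m / 2)) + 8 * (2 * k / lam / n + lam / 2) := by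
  have := R.isProbabilityMeasure_law
  set α := 3 / 4 - 1 / 240 + ε with hα
  set b := 1 + 16 * n ^ 4 * Real.exp (-(ε ^ 2 * m / 8)) + 4 * Real.exp (-(ε ^ 2 * m / 32)) +
    16 * n ^ 2 * Real.exp (-(ε ^ 2 * m / 2)) + 8 * (2 * k / lam / n + lam / 2) with hb
  -- Success expressed through the first messages: measurable, and almost surely equal to
  -- `AchievesOn` for a simultaneous protocol.
  set E : Bool × (Fin n × Sample m n) → Set (Protocol m (BXOS m)) := fun j =>
    {P | P.alloc [P.alice (input j.1 j.2.1 j.2.2 false) []]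
      [P.bob (input j.1 j.2.1 j.2.2 true) []] ∈
      {O | α * opt (input j.1 j.2.1 j.2.2 false).1 (input j.1 j.2.1 j.2.2 true).1 ≤
        (input j.1 j.2.1 j.2.2 false).1 O.1 + (input j.1 j.2.1 j.2.2 true).1 O.2}} with hE
  have hcc : ∀ᵐ P ∂(R.law), P.cc ≤ (k : ℕ∞) :=
    (ae_le_essSup (f := fun P : Protocol m (BXOS m) => P.cc) (μ := R.law)).mono
      fun P hP => hP.trans hk
  have hmean := expect_measureReal_le R.law E
    (fun j => Protocol.measurableSet_alloc_first _ _ _) (b / 2) (by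
      filter_upwards [hsim, hcc] with P hP hPk
      have h := sum_achievesOn_le (n := n) hP hPk hε hlam
      rw [prob_prod, Fintype.expect_eq_sum_div_card, Fintype.card_bool]
      refine (div_le_div_iff_of_pos_right (by norm_num)).2 (le_trans (le_of_eq ?_) h)
      refine sum_congr rfl fun θ _ => ?_
      rw [prob_prod]
      refine expect_congr rfl fun i _ => ?_
      congr 1
      funext ω
      exact propext (hP.achievesOn_iff _ _ _).symm)
  have hp : ∀ j, p ≤ R.law.real (E j) := fun j => by
    refine (happ (input j.1 j.2.1 j.2.2 false) (input j.1 j.2.1 j.2.2 true)).trans (le_of_eq ?_)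
    refine measureReal_congr ?_
    filter_upwards [hsim] with P hP
    exact propext (hP.achievesOn_iff _ _ _)
  have := (le_expect univ_nonempty fun j _ => hp j).trans hmean
  linarith

/-- With `z = exp (-(L / 250))`, the error is at most (256 + 4 + 64 + 20) `z` = 344 `z`, and `z` is
the square of `w = exp (-(L / 500))`. -/
theorem error_lt {L C : ℝ} (hL : 10 ^ 10 < L) (hC : C < Real.exp (L / 500)) {n : ℝ}
    (hn : Real.exp (L / 100) ≤ n) (hn' : n ≤ 2 * Real.exp (L / 100)) :
    16 * n ^ 4 * Real.exp (-(L / 8)) + 4 * Real.exp (-(L / 32)) +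
        16 * n ^ 2 * Real.exp (-(L / 2)) +
        8 * (2 * C / Real.exp (-(L / 250)) / n + Real.exp (-(L / 250)) / 2) <
      2 * Real.exp (-(L / 500)) := by
  have hn0 : 0 < n := (Real.exp_pos _).trans_le hn
  set z := Real.exp (-(L / 250)) with hz
  have hz0 : 0 < z := Real.exp_pos _
  have h1 : 16 * n ^ 4 * Real.exp (-(L / 8)) ≤ 256 * z := by
    calc 16 * n ^ 4 * Real.exp (-(L / 8))
        ≤ 16 * (2 * Real.exp (L / 100)) ^ 4 * Real.exp (-(L / 8)) := by gcongr
      _ = 256 * Real.exp (4 * (L / 100) + -(L / 8)) := by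
          rw [Real.exp_add, show (4 : ℝ) = ((4 : ℕ) : ℝ) by norm_num, Real.exp_nat_mul]
          ring
      _ ≤ 256 * z := mul_le_mul_of_nonneg_left (Real.exp_le_exp.2 (by linarith)) (by norm_num)
  have h2 : 4 * Real.exp (-(L / 32)) ≤ 4 * z :=
    mul_le_mul_of_nonneg_left (Real.exp_le_exp.2 (by linarith)) (by norm_num)
  have h3 : 16 * n ^ 2 * Real.exp (-(L / 2)) ≤ 64 * z := by
    calc 16 * n ^ 2 * Real.exp (-(L / 2))
        ≤ 16 * (2 * Real.exp (L / 100)) ^ 2 * Real.exp (-(L / 2)) := by gcongr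
      _ = 64 * Real.exp (2 * (L / 100) + -(L / 2)) := by
          rw [Real.exp_add, show (2 : ℝ) = ((2 : ℕ) : ℝ) by norm_num, Real.exp_nat_mul]
          push_cast
          ring
      _ ≤ 64 * z := mul_le_mul_of_nonneg_left (Real.exp_le_exp.2 (by linarith)) (by norm_num)
  have h4 : 2 * C / z / n ≤ 2 * z := by
    rw [div_le_iff₀ hn0, div_le_iff₀ hz0]
    calc 2 * C ≤ 2 * Real.exp (L / 500) := by linarith
      _ = 2 * (z * Real.exp (L / 100) * z) := by
          rw [hz, ← Real.exp_add, ← Real.exp_add]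
          ring_nf
      _ ≤ 2 * (z * n * z) := by gcongr
      _ = 2 * z * n * z := by ring
  have h5 : z = Real.exp (-(L / 500)) * Real.exp (-(L / 500)) := by
    rw [hz, ← Real.exp_add]
    ring_nf
  set w := Real.exp (-(L / 500)) with hw
  have h6 : 344 * w < 2 := by
    have h7 := Real.add_one_le_exp (L / 500)
    have h8 : w * Real.exp (L / 500) = 1 := by rw [hw, ← Real.exp_add]; simp
    have h9 : 0 < w := Real.exp_pos _
    nlinarith
  have h10 : 0 < w := Real.exp_pos _
  nlinarith

end Randomized

end CombAuction

end

theorem mainTheorem2 (ε : ℝ) (hε : 0 < ε) (m : ℕ) (hm : (10 : ℝ) ^ 10 / ε ^ 2 < (m : ℝ))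
    (R : CombAuction.RandomizedProtocol m (CombAuction.BXOS m))
    (hsim : R.IsSimultaneous)
    (happ : R.IsApproxWithProb (3 / 4 - 1 / 240 + ε)
      (1 / 2 + Real.exp (-(ε ^ 2 * (m : ℝ) / 500)))) :
    ENNReal.ofReal (Real.exp (ε ^ 2 * (m : ℝ) / 500)) ≤ ((R.cc : ℕ∞) : ℝ≥0∞) := by
  by_contra hcon
  obtain ⟨k, hk⟩ : ∃ k : ℕ, R.cc = (k : ℕ∞) := by
    refine ⟨R.cc.toNat, (ENat.natCast_toNat fun htop => hcon ?_).symm⟩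
    rw [htop]
    simp
  have hkL : (k : ℝ) < Real.exp (ε ^ 2 * m / 500) := by
    rw [hk, ENat.toENNReal_coe, not_le, ← ENNReal.ofReal_natCast] at hcon
    exact (ENNReal.ofReal_lt_ofReal_iff (Real.exp_pos _)).1 hcon
  have hL : (10 : ℝ) ^ 10 < ε ^ 2 * m := by
    rwa [div_lt_iff₀ (by positivity), mul_comm] at hm
  -- Large enough to hide a clause from messages of fewer than `exp (L / 500)` bits, where `L = ε ^
  -- 2 * m`, yet small enough that the union bound over `n ^ 4` clause choices survives the tail
  -- `exp (-(L / 8))`.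
  set n := ⌈Real.exp (ε ^ 2 * m / 100)⌉₊ with hn
  have hn1 : Real.exp (ε ^ 2 * m / 100) ≤ n := Nat.le_ceil _
  have hn2 : (n : ℝ) ≤ 2 * Real.exp (ε ^ 2 * m / 100) := by
    have h1 := Nat.ceil_lt_add_one (Real.exp_pos (ε ^ 2 * m / 100)).le
    have h2 : 1 ≤ Real.exp (ε ^ 2 * m / 100) := Real.one_le_exp (by positivity)
    rw [← hn] at h1
    linarith
  have : NeZero n := ⟨by
    have := (Real.exp_pos (ε ^ 2 * m / 100)).trans_le hn1
    intro h0
    rw [h0] at this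
    simp at this⟩
  have h1 := CombAuction.two_mul_prob_le (n := n) R hsim hk.le hε.le happ
    (Real.exp_pos (-(ε ^ 2 * m / 250)))
  have h2 := CombAuction.error_lt hL hkL hn1 hn2
  linarith
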